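/- Let $D\ge 2$ be an integer. For a nonempty open, bounded, convex set $\Omega\subset\mathbb{R}^D$ put $$\delta(\Omega):=\frac{1}{|\Omega|}\int_\Omega \operatorname{dist}(x,\partial\Omega)\,dx ,$$ where $|\Omega|$ is the Lebesgue measure, and for $r>0$ let $\mathcal P^D[r]$ be the family of all such $\Omega$ with $\delta(\Omega)=r$. For $p\in(1,\infty)$ let $u_p\in W^{1,p}_0(\Omega)$ be the unique weak solution of $-\operatorname{div}(|\nabla u|^{p-2}\nabla u)=1$ in $\Omega$, $u=0$ on $\partial\Omega$, and put $$T_p(\Omega):=\int_\Omega u_p\,dx,\qquad T(p;\Omega):=|\Omega|^{p-1}\,T_p(\Omega)^{1-p}.$$ Then there is a constant $\overline\gamma_D\in\left[\frac{2}{D(D+1)},1\right)$, depending only on $D$, such that the following holds for all real numbers $0<a<b$. (i) If $\overline\gamma_D\,b<a$, then there exist a real number $q_D\in(1,\infty)$ and sets $\Omega_a\in\mathcal P^D[a]$, $\Omega_b\in\mathcal P^D[b]$ with $T(q_D;\Omega_a)<T(q_D;\Omega_b)$. (ii) If $\overline\gamma_D\,b\ge a$, then $T(p;\Omega_b)\le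 T(p;\Omega_a)$ for all $\Omega_a\in\mathcal P^D[a]$, all $\Omega_b\in\mathcal P^D[b]$ and all $p\in(1,\infty)$; if $\overline\gamma_D\,b>a$, then this inequality is strict for all such $\Omega_a$, $\Omega_b$ and $p$. -/

import Mathlib

open MeasureTheory Filter Topology
open scoped ContDiff Gradient

namespace PTorsion

/-- Open, bounded, convex (nonempty) domains of `ℝ^D`. -/
structure IsConvexDomain {D : ℕ} (Ω : Set (EuclideanSpace ℝ (Fin D))) : Prop where
  nonempty : Ω.Nonempty
  isOpen : IsOpen Ω
  isBounded : Bornology.IsBounded Ω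
  convex : Convex ℝ Ω

/-- The average over `Ω` of the distance to the boundary of `Ω`. -/
noncomputable def avgDist {D : ℕ} (Ω : Set (EuclideanSpace ℝ (Fin D))) : ℝ :=
  (volume.real Ω)⁻¹ * ∫ x in Ω, Metric.infDist x (frontier Ω)

/-- The convex domains whose average distance to the boundary equals `r`. -/
def domainsWithAvgDist (D : ℕ) (r : ℝ) : Set (Set (EuclideanSpace ℝ (Fin D))) :=
  {Ω | IsConvexDomain Ω ∧ avgDist Ω = r}

/-- Test functions: the space `C_c^∞(Ω)`. -/
structure IsTestFunction {D : ℕ} (Ω : Set (EuclideanSpace ℝ (Fin D)))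
    (φ : EuclideanSpace ℝ (Fin D) → ℝ) : Prop where
  contDiff : ContDiff ℝ ∞ φ
  hasCompactSupport : HasCompactSupport φ
  tsupport_subset : tsupport φ ⊆ Ω

/-- `G` is the weak (distributional) gradient of `u` in `Ω`. -/
def HasWeakGradient {D : ℕ} (Ω : Set (EuclideanSpace ℝ (Fin D)))
    (u : EuclideanSpace ℝ (Fin D) → ℝ)
    (G : EuclideanSpace ℝ (Fin D) → EuclideanSpace ℝ (Fin D)) : Prop :=
  ∀ φ : EuclideanSpace ℝ (Fin D) → ℝ, IsTestFunction Ω φ →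
    ∫ x in Ω, u x • ∇ φ x = -∫ x in Ω, φ x • G x

/-- `u ∈ W^{1,p}(Ω)`, with weak gradient `G`. -/
structure MemSobolev {D : ℕ} (p : ℝ) (Ω : Set (EuclideanSpace ℝ (Fin D)))
    (u : EuclideanSpace ℝ (Fin D) → ℝ)
    (G : EuclideanSpace ℝ (Fin D) → EuclideanSpace ℝ (Fin D)) : Prop where
  memLp : MemLp u (ENNReal.ofReal p) (volume.restrict Ω)
  memLp_grad : MemLp G (ENNReal.ofReal p) (volume.restrict Ω)
  hasWeakGradient : HasWeakGradient Ω u G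

/-- `u ∈ W_0^{1,p}(Ω)`, with weak gradient `G`: `u` lies in the closure of `C_c^∞(Ω)` in
`W^{1,p}(Ω)`. -/
structure MemSobolevZero {D : ℕ} (p : ℝ) (Ω : Set (EuclideanSpace ℝ (Fin D)))
    (u : EuclideanSpace ℝ (Fin D) → ℝ)
    (G : EuclideanSpace ℝ (Fin D) → EuclideanSpace ℝ (Fin D)) : Prop where
  memSobolev : MemSobolev p Ω u G
  approx : ∃ φ : ℕ → EuclideanSpace ℝ (Fin D) → ℝ, (∀ n, IsTestFunction Ω (φ n)) ∧
    Tendsto (fun n => eLpNorm (fun x => φ n x - u x) (ENNReal.ofReal p) (volume.restrict Ω))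
      atTop (𝓝 0) ∧
    Tendsto (fun n => eLpNorm (fun x => ∇ (φ n) x - G x) (ENNReal.ofReal p) (volume.restrict Ω))
      atTop (𝓝 0)

/-- `u ∈ W_0^{1,p}(Ω)` is a weak solution of `-div (|∇u|^{p-2} ∇u) = 1` in `Ω`, `u = 0` on
`∂Ω`. -/
def IsTorsionFunction {D : ℕ} (p : ℝ) (Ω : Set (EuclideanSpace ℝ (Fin D)))
    (u : EuclideanSpace ℝ (Fin D) → ℝ) : Prop :=
  ∃ G : EuclideanSpace ℝ (Fin D) → EuclideanSpace ℝ (Fin D), MemSobolevZero p Ω u G ∧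
    ∀ φ : EuclideanSpace ℝ (Fin D) → ℝ, IsTestFunction Ω φ →
      ∫ x in Ω, ‖G x‖ ^ (p - 2) * inner ℝ (G x) (∇ φ x) = ∫ x in Ω, φ x

open Classical in
/-- The `p`-torsion function of `Ω`. The weak solution exists and is unique up to null sets for
every convex domain and every `p > 1`; outside that setting the default value is `0`. -/
noncomputable def torsionFunction {D : ℕ} (p : ℝ) (Ω : Set (EuclideanSpace ℝ (Fin D))) :
    EuclideanSpace ℝ (Fin D) → ℝ :=
  if h : ∃ u, IsTorsionFunction p Ω u then h.choose else 0

/-- The `p`-torsional rigidity `T_p(Ω) = ∫_Ω u_p`. -/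
noncomputable def torsionalRigidity {D : ℕ} (p : ℝ) (Ω : Set (EuclideanSpace ℝ (Fin D))) : ℝ :=
  ∫ x in Ω, torsionFunction p Ω x

/-- The normalized `p`-torsional rigidity `T(p; Ω) = |Ω|^{p-1} T_p(Ω)^{1-p}`. -/
noncomputable def normalizedRigidity {D : ℕ} (p : ℝ) (Ω : Set (EuclideanSpace ℝ (Fin D))) : ℝ :=
  volume.real Ω ^ (p - 1) * torsionalRigidity p Ω ^ (1 - p)

end PTorsion

/-!
Write `δ` for the average distance to the boundary. Then `T(p; Ω) = (σ_p(Ω) / δ(Ω)) ^ p`, where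
`σ_p(Ω)` is invariant under scaling, so the theorem holds with `γ_D` the infimum of the quotients
`σ_p(Ω) / σ_p(Ω')`; what has to be shown is `2 / (D (D + 1)) ≤ γ_D < 1`.

By duality, `T_p(Ω) ^ (1 - 1 / p)` is the best constant `M` in `|∫ φ| ≤ M ‖∇φ‖_p` for test
functions `φ`. Testing with truncations of the distance function gives `σ_p(Ω) ≤ 1`. The inequality
`∫ |φ| ≤ r ∫ |∇φ|`, where `r` is the inradius, together with `r ≤ (D + 1) δ(Ω)`, which holds because
the distance function is concave on `Ω`, gives `σ_p(Ω) ≥ 1 / (D + 1)`. Hence `γ_D ≥ 1 / (D + 1)`.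

For a ball, integrating by parts against the field `x` improves the lower bound to
`σ_p ≥ D / (D + 1) ≥ 2 / 3`, while a thin box has `σ_p < 2 / 3` for `p` close to `1`, since its mean
distance to the boundary is about half of its inradius. Hence `γ_D < 1`.
-/

namespace PTorsion

open scoped Pointwise

section Frontier

lemma subset_of_disjoint_frontier {X : Type*} [TopologicalSpace X] {Ω P : Set X} (hΩ : IsOpen Ω)
    (hP : IsPreconnected P) (hPf : Disjoint P (frontier Ω)) (hne : (P ∩ Ω).Nonempty) : P ⊆ Ω := by
  refine hP.subset_left_of_subset_union hΩ isClosed_closure.isOpen_compl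
    (Set.disjoint_compl_right_iff_subset.2 subset_closure) (fun x hx => ?_) hne
  by_cases hxc : x ∈ closure Ω
  · rw [closure_eq_self_union_frontier] at hxc
    exact hxc.elim Or.inl fun h => (Set.disjoint_left.1 hPf hx h).elim
  · exact Or.inr hxc

lemma le_infDist_frontier {X : Type*} [PseudoMetricSpace X] {Ω : Set X} (hΩ : IsOpen Ω)
    (hfr : (frontier Ω).Nonempty) {x : X} {r : ℝ} (h : Metric.ball x r ⊆ Ω) :
    r ≤ Metric.infDist x (frontier Ω) := by
  refine (Metric.le_infDist hfr).2 fun z hz => ?_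
  by_contra! hlt
  rw [dist_comm] at hlt
  exact (Set.disjoint_iff_inter_eq_empty.2 hΩ.inter_frontier_eq).notMem_of_mem_left (h hlt) hz

lemma ball_infDist_frontier_subset {E : Type*} [SeminormedAddCommGroup E] [NormedSpace ℝ E]
    {Ω : Set E} (hΩ : IsOpen Ω) {x : E} (hx : x ∈ Ω) :
    Metric.ball x (Metric.infDist x (frontier Ω)) ⊆ Ω := by
  rcases (Metric.infDist_nonneg (x := x) (s := frontier Ω)).eq_or_lt with h0 | h0
  · simp [← h0]
  · exact subset_of_disjoint_frontier hΩ (convex_ball _ _).isPreconnected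
      Metric.disjoint_ball_infDist ⟨x, Metric.mem_ball_self h0, hx⟩

lemma infDist_frontier_pos {X : Type*} [PseudoMetricSpace X] {Ω : Set X} (hΩ : IsOpen Ω)
    (hfr : (frontier Ω).Nonempty) {x : X} (hx : x ∈ Ω) : 0 < Metric.infDist x (frontier Ω) :=
  (isClosed_frontier.notMem_iff_infDist_pos hfr).1
    ((Set.disjoint_iff_inter_eq_empty.2 hΩ.inter_frontier_eq).notMem_of_mem_left hx)

lemma concaveOn_infDist_frontier {E : Type*} [SeminormedAddCommGroup E] [NormedSpace ℝ E]
    {Ω : Set E} (hΩ : IsOpen Ω) (hΩc : Convex ℝ Ω) (hfr : (frontier Ω).Nonempty) :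
    ConcaveOn ℝ Ω fun x => Metric.infDist x (frontier Ω) := by
  refine concaveOn_iff_forall_pos.2 ⟨hΩc, fun x hx y hy a b ha hb hab => ?_⟩
  set r := Metric.infDist x (frontier Ω)
  set s := Metric.infDist y (frontier Ω)
  have hr : 0 < r := infDist_frontier_pos hΩ hfr hx
  have hs : 0 < s := infDist_frontier_pos hΩ hfr hy
  refine le_infDist_frontier hΩ hfr ?_
  have hsum : Metric.ball (a • x + b • y) (a * r + b * s) =
      a • Metric.ball x r + b • Metric.ball y s := by
    rw [smul_ball ha.ne', smul_ball hb.ne', Real.norm_of_nonneg ha.le, Real.norm_of_nonneg hb.le,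
      ball_add_ball (by positivity) (by positivity)]
  simp only [smul_eq_mul, hsum]
  rintro _ ⟨_, ⟨u, hu, rfl⟩, _, ⟨v, hv, rfl⟩, rfl⟩
  exact hΩc (ball_infDist_frontier_subset hΩ hx hu) (ball_infDist_frontier_subset hΩ hy hv)
    ha.le hb.le hab

end Frontier

section ConcaveAverage

variable {E : Type*} [NormedAddCommGroup E] [NormedSpace ℝ E] {Ω : Set E} {f : E → ℝ}

lemma homothety_image_subset_superlevel (hf : ConcaveOn ℝ Ω f) (hf0 : ∀ x ∈ Ω, 0 ≤ f x) {c : E}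
    (hc : c ∈ Ω) {s : ℝ} (hs : s ∈ Set.Icc 0 1) :
    AffineMap.homothety c (1 - s) '' Ω ⊆ {x | s * f c ≤ f x} ∩ Ω := by
  have hs1 : 0 ≤ 1 - s := sub_nonneg.2 hs.2
  rintro _ ⟨x, hx, rfl⟩
  have hx' : AffineMap.homothety c (1 - s) x = s • c + (1 - s) • x := by
    rw [AffineMap.homothety_apply, vsub_eq_sub, vadd_eq_add]
    module
  rw [hx']
  refine ⟨?_, hf.1 hc hx hs.1 hs1 (by ring)⟩
  have := hf.2 hc hx hs.1 hs1 (by ring)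
  simp only [smul_eq_mul] at this
  exact (le_add_of_nonneg_right (mul_nonneg hs1 (hf0 x hx))).trans this

variable [FiniteDimensional ℝ E] [MeasurableSpace E] [BorelSpace E] {μ : Measure E}
  [μ.IsAddHaarMeasure]

open Module in
lemma pow_mul_measureReal_le_measure_superlevel (hΩ : MeasurableSet Ω) (hf : ConcaveOn ℝ Ω f)
    (hf0 : ∀ x ∈ Ω, 0 ≤ f x) {c : E} (hc : c ∈ Ω) {s : ℝ} (hs : s ∈ Set.Icc 0 1) :
    ENNReal.ofReal ((1 - s) ^ finrank ℝ E * μ.real Ω) ≤ μ.restrict Ω {x | s * f c ≤ f x} := by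
  have hpow : 0 ≤ (1 - s) ^ finrank ℝ E := pow_nonneg (sub_nonneg.2 hs.2) _
  calc ENNReal.ofReal ((1 - s) ^ finrank ℝ E * μ.real Ω)
      = ENNReal.ofReal |(1 - s) ^ finrank ℝ E| * ENNReal.ofReal (μ.real Ω) := by
        rw [ENNReal.ofReal_mul hpow, abs_of_nonneg hpow]
    _ ≤ ENNReal.ofReal |(1 - s) ^ finrank ℝ E| * μ Ω := by
        gcongr
        exact ENNReal.ofReal_toReal_le
    _ = μ (AffineMap.homothety c (1 - s) '' Ω) := (Measure.addHaar_image_homothety μ c _ Ω).symm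
    _ ≤ μ.restrict Ω {x | s * f c ≤ f x} := by
        rw [Measure.restrict_apply' hΩ]
        exact measure_mono (homothety_image_subset_superlevel hf hf0 hc hs)

open Module in
lemma mul_measureReal_le_setIntegral_of_concaveOn (hΩ : MeasurableSet Ω) (hf : ConcaveOn ℝ Ω f)
    (hf0 : ∀ x ∈ Ω, 0 ≤ f x) (hfi : IntegrableOn f Ω μ) {c : E} (hc : c ∈ Ω) :
    f c * μ.real Ω ≤ (finrank ℝ E + 1) * ∫ x in Ω, f x ∂μ := by
  have hf0' : 0 ≤ᵐ[μ.restrict Ω] f := ae_restrict_of_forall_mem hΩ hf0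
  rcases (hf0 c hc).eq_or_lt with h0 | hM
  · rw [← h0, zero_mul]
    exact mul_nonneg (by positivity) (integral_nonneg_of_ae hf0')
  set M := f c
  have hs : ∀ t ∈ Set.Ioc 0 M, t / M ∈ Set.Icc 0 1 := fun t ht =>
    ⟨(div_pos ht.1 hM).le, (div_le_one hM).2 ht.2⟩
  have hlevels : ∫ t in 0..M, (1 - t / M) ^ finrank ℝ E * μ.real Ω =
      M / (finrank ℝ E + 1) * μ.real Ω := by
    rw [intervalIntegral.integral_mul_const,
      intervalIntegral.integral_comp_sub_div (fun x => x ^ finrank ℝ E) hM.ne', zero_div, sub_zero,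
      div_self hM.ne', sub_self, integral_pow]
    simp [div_eq_mul_inv]
  have hlayer : ENNReal.ofReal (M / (finrank ℝ E + 1) * μ.real Ω) ≤
      ENNReal.ofReal (∫ x in Ω, f x ∂μ) := by
    rw [← hlevels, intervalIntegral.integral_of_le hM.le, ofReal_integral_eq_lintegral_ofReal,
      ofReal_integral_eq_lintegral_ofReal hfi hf0',
      lintegral_eq_lintegral_meas_le _ hf0' hfi.1.aemeasurable]
    · refine (setLIntegral_mono' measurableSet_Ioc fun t ht => ?_).trans
        (lintegral_mono_set Set.Ioc_subset_Ioi_self)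
      have := pow_mul_measureReal_le_measure_superlevel (μ := μ) hΩ hf hf0 hc (hs t ht)
      rwa [div_mul_cancel₀ _ hM.ne'] at this
    · exact Continuous.integrableOn_Ioc (by fun_prop)
    · exact ae_restrict_of_forall_mem measurableSet_Ioc fun t ht =>
        mul_nonneg (pow_nonneg (sub_nonneg.2 (hs t ht).2) _) measureReal_nonneg
  have := (ENNReal.ofReal_le_ofReal_iff (integral_nonneg_of_ae hf0')).1 hlayer
  rw [div_mul_eq_mul_div, div_le_iff₀ (by positivity)] at this
  linarith

end ConcaveAverage

section Polyhedron

variable {E ι : Type*} [NormedAddCommGroup E] [InnerProductSpace ℝ E] {n : ι → E} {c : ι → ℝ}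

/-- For unit normals `n i`, the signed distance from `x` to the hyperplane `⟪n i, ·⟫ = c i`,
positive on the side of the polyhedron. -/
def slack (n : ι → E) (c : ι → ℝ) (i : ι) (x : E) : ℝ := c i - inner ℝ (n i) x

/-- The open polyhedron with outer normals `n i` and offsets `c i`. -/
def openPolyhedron (n : ι → E) (c : ι → ℝ) : Set E := {x | ∀ i, 0 < slack n c i x}

/-- The points of the polyhedron whose nearest facet is the `i`-th one; ties are broken by the
order of the indices, so that the cells partition the polyhedron. -/
def facetCell [LinearOrder ι] (n : ι → E) (c : ι → ℝ) (i : ι) : Set E :=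
  {x ∈ openPolyhedron n c | ∀ j, toLex (slack n c i x, i) ≤ toLex (slack n c j x, j)}

@[fun_prop]
lemma continuous_slack (i : ι) : Continuous (slack n c i) := by
  unfold slack
  fun_prop

lemma slack_add_smul (i : ι) (x : E) (s : ℝ) (y : E) :
    slack n c i (x + s • y) = slack n c i x - s * inner ℝ (n i) y := by
  simp only [slack, inner_add_right, real_inner_smul_right]
  ring

lemma convex_openPolyhedron : Convex ℝ (openPolyhedron n c) := by
  have : openPolyhedron n c = ⋂ i, {x | innerSL ℝ (n i) x < c i} := by
    ext x
    simp [openPolyhedron, slack]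
  rw [this]
  exact convex_iInter fun i => convex_halfSpace_lt (innerSL ℝ (n i)).toLinearMap.isLinear _

lemma ball_subset_openPolyhedron (hn : ∀ i, ‖n i‖ = 1) {x : E} {r : ℝ}
    (h : ∀ i, r ≤ slack n c i x) : Metric.ball x r ⊆ openPolyhedron n c := fun z hz i => by
  have hi : inner ℝ (n i) (z - x) ≤ ‖z - x‖ := by simpa [hn] using real_inner_le_norm (n i) (z - x)
  rw [inner_sub_right] at hi
  have hr := h i
  simp only [slack, mem_ball_iff_norm] at *
  linarith

variable [LinearOrder ι]

lemma slack_le_of_mem_facetCell {i : ι} {x : E} (hx : x ∈ facetCell n c i) (j : ι) :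
    slack n c i x ≤ slack n c j x := by
  rcases Prod.Lex.le_iff.1 (hx.2 j) with h | h
  exacts [h.le, h.1.le]

lemma pairwise_disjoint_facetCell : Pairwise (Function.onFun Disjoint (facetCell n c)) :=
  fun i j hij => Set.disjoint_left.2 fun _ hi hj =>
    hij (congrArg (fun z => (ofLex z).2) (le_antisymm (hi.2 j) (hj.2 i)))

lemma iUnion_facetCell [Finite ι] [Nonempty ι] : ⋃ i, facetCell n c i = openPolyhedron n c := by
  refine subset_antisymm (Set.iUnion_subset fun i x hx => hx.1) fun x hx => ?_
  obtain ⟨i, hi⟩ := Finite.exists_min fun j => toLex (slack n c j x, j)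
  exact Set.mem_iUnion.2 ⟨i, hx, hi⟩

lemma measurableSet_facetCell [Countable ι] [MeasurableSpace E] [BorelSpace E] (i : ι) :
    MeasurableSet (facetCell n c i) := by
  have hpoly : openPolyhedron n c = ⋂ j, {x | 0 < slack n c j x} := by
    ext x
    simp [openPolyhedron]
  have hcell : facetCell n c i = openPolyhedron n c ∩ ⋂ j, ({x | slack n c i x < slack n c j x} ∪
      {x | slack n c i x = slack n c j x ∧ i ≤ j}) := by
    ext x
    simp [facetCell, Prod.Lex.le_iff]
  rw [hcell, hpoly]
  refine .inter (.iInter fun j => measurableSet_lt measurable_const ?_) (.iInter fun j =>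
    (measurableSet_lt ?_ ?_).union ((measurableSet_eq_fun ?_ ?_).inter (.const _)))
  all_goals exact (continuous_slack _).measurable

lemma add_smul_mem_facetCell (hn : ∀ i, ‖n i‖ = 1) {i : ι} {x : E} (hx : x ∈ facetCell n c i)
    {s : ℝ} (hs : 0 ≤ s) (hsi : s < slack n c i x) : x + s • n i ∈ facetCell n c i := by
  have hi : slack n c i (x + s • n i) = slack n c i x - s := by
    simp [slack_add_smul, hn]
  have hj : ∀ j, slack n c j x - s ≤ slack n c j (x + s • n i) := fun j => by
    have : inner ℝ (n j) (n i) ≤ 1 := by simpa [hn] using real_inner_le_norm (n j) (n i)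
    rw [slack_add_smul]
    linarith [mul_le_of_le_one_right hs this]
  refine ⟨fun j => ?_, fun j => Prod.Lex.le_iff.2 ?_⟩
  · linarith [hj j, slack_le_of_mem_facetCell hx j]
  · simp only [ofLex_toLex, hi]
    rcases (hj j).eq_or_lt with h | h
    · rw [← h, sub_lt_sub_iff_right, sub_left_inj]
      exact Prod.Lex.le_iff.1 (hx.2 j)
    · exact .inl (by linarith [slack_le_of_mem_facetCell hx j])

end Polyhedron

section Separation

variable {E : Type*} [NormedAddCommGroup E] [InnerProductSpace ℝ E]

lemma exists_unit_normal_inner_lt [CompleteSpace E] {K : Set E} (hK : IsCompact K)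
    (hKc : Convex ℝ K) (hKne : K.Nonempty) {y : E} (hy : y ∉ K) :
    ∃ (n : E) (c : ℝ), ‖n‖ = 1 ∧ (∀ x ∈ K, inner ℝ n x < c) ∧ c < inner ℝ n y := by
  obtain ⟨f, u, w, hfK, huw, hfy⟩ := geometric_hahn_banach_compact_closed hKc hK
    (convex_singleton y) isClosed_singleton (Set.disjoint_singleton_right.2 hy)
  have hfy' : u < f y := huw.trans (hfy y rfl)
  obtain ⟨g, rfl⟩ := (InnerProductSpace.toDual ℝ E).surjective f
  simp only [InnerProductSpace.toDual_apply_apply] at hfK hfy'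
  have hg : 0 < ‖g‖ := by
    obtain ⟨x, hx⟩ := hKne
    refine norm_pos_iff.2 ?_
    rintro rfl
    simpa using (hfK x hx).trans hfy'
  refine ⟨‖g‖⁻¹ • g, ‖g‖⁻¹ * u, by simp [norm_smul, hg.ne'], fun x hx => ?_, ?_⟩ <;>
    rw [real_inner_smul_left]
  · exact mul_lt_mul_of_pos_left (hfK x hx) (inv_pos.2 hg)
  · exact mul_lt_mul_of_pos_left hfy' (inv_pos.2 hg)

lemma exists_isCompact_convex_between {E : Type*} [NormedAddCommGroup E] [NormedSpace ℝ E]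
    [FiniteDimensional ℝ E] {Ω S : Set E} (hΩ : IsOpen Ω) (hΩc : Convex ℝ Ω) (hS : IsCompact S)
    (hSΩ : S ⊆ Ω) : ∃ K, IsCompact K ∧ Convex ℝ K ∧ S ⊆ K ∧ K ⊆ Ω := by
  classical
  obtain ⟨u, hSu, huΩ⟩ : ∃ u : Finset E, S ⊆ convexHull ℝ (u : Set E) ∧ (u : Set E) ⊆ Ω := by
    refine hS.induction_on ⟨∅, by simp⟩ (fun A B hAB ⟨u, hu, huΩ⟩ => ⟨u, hAB.trans hu, huΩ⟩)
      (fun A B ⟨u, hu, huΩ⟩ ⟨v, hv, hvΩ⟩ => ⟨u ∪ v, ?_, by simp [huΩ, hvΩ]⟩) fun x hx => ?_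
    · rw [Finset.coe_union]
      exact Set.union_subset (hu.trans (convexHull_mono Set.subset_union_left))
        (hv.trans (convexHull_mono Set.subset_union_right))
    · obtain ⟨u, hxu, huΩ⟩ :=
        (convex_singleton x).exists_subset_interior_convexHull_finset_of_isCompact
          isCompact_singleton (by simpa using hΩ.mem_nhds (hSΩ hx))
      rw [Set.singleton_subset_iff, mem_interior_iff_mem_nhds] at hxu
      exact ⟨_, mem_nhdsWithin_of_mem_nhds hxu, u, subset_rfl, (subset_convexHull ℝ _).trans huΩ⟩
  exact ⟨convexHull ℝ u, u.finite_toSet.isCompact_convexHull ℝ, convex_convexHull ℝ _, hSu,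
    convexHull_min huΩ hΩc⟩

variable [FiniteDimensional ℝ E]

lemma exists_openPolyhedron_between {Ω K : Set E} (hΩ : IsOpen Ω) (hΩb : Bornology.IsBounded Ω)
    (hK : IsCompact K) (hKc : Convex ℝ K) (hKne : K.Nonempty) (hKΩ : K ⊆ Ω) :
    ∃ (m : ℕ) (n : Fin m → E) (c : Fin m → ℝ), (∀ i, ‖n i‖ = 1) ∧
      K ⊆ openPolyhedron n c ∧ openPolyhedron n c ⊆ Ω := by
  have hfrontier : IsCompact (frontier Ω) := Metric.isCompact_of_isClosed_isBounded
    isClosed_frontier (hΩb.closure.subset frontier_subset_closure)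
  choose n c hn hnK hny using fun y : frontier Ω => exists_unit_normal_inner_lt hK hKc hKne
    fun hy => (Set.disjoint_iff_inter_eq_empty.2 hΩ.inter_frontier_eq).notMem_of_mem_left
      (hKΩ hy) y.2
  obtain ⟨T, hT⟩ := hfrontier.elim_finite_subcover (fun y => {z | c y < inner ℝ (n y) z})
    (fun y => isOpen_lt continuous_const (by fun_prop))
    fun z hz => Set.mem_iUnion.2 ⟨⟨z, hz⟩, hny ⟨z, hz⟩⟩
  let e := T.equivFin.symm
  have hKP : K ⊆ openPolyhedron (fun i => n (e i)) fun i => c (e i) :=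
    fun x hx i => sub_pos.2 (hnK _ x hx)
  refine ⟨T.card, _, _, fun i => hn _, hKP, ?_⟩
  refine subset_of_disjoint_frontier hΩ convex_openPolyhedron.isPreconnected ?_
    (hKne.mono fun x hx => ⟨hKP hx, hKΩ hx⟩)
  refine Set.disjoint_left.2 fun x hx hxf => ?_
  obtain ⟨y, hy, hxy⟩ := Set.mem_iUnion₂.1 (hT hxf)
  have := hx (e.symm ⟨y, hy⟩)
  simp only [slack, Equiv.apply_symm_apply, sub_pos] at this
  exact lt_asymm this hxy

end Separation

section Poincare

section Segments

variable {E F : Type*} [NormedAddCommGroup E] [NormedSpace ℝ E] [NormedAddCommGroup F]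
  [NormedSpace ℝ F] [CompleteSpace F] {v : E → F} {n : E}

lemma enorm_le_lintegral_enorm_fderiv_of_segment (hv : ContDiff ℝ 1 v) (hn : ‖n‖ = 1) {x : E}
    {t : ℝ} (ht : 0 ≤ t) (hzero : v (x + t • n) = 0) :
    ‖v x‖ₑ ≤ ∫⁻ s in Set.Ico 0 t, ‖fderiv ℝ v (x + s • n)‖ₑ := by
  have hder : ∀ s : ℝ, HasDerivAt (fun s : ℝ => v (x + s • n)) (fderiv ℝ v (x + s • n) n) s := by
    intro s
    have hline : HasDerivAt (fun s : ℝ => x + s • n) n s := by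
      simpa using ((hasDerivAt_id s).smul_const n).const_add x
    exact (hv.differentiable (by norm_num) _).hasFDerivAt.comp_hasDerivAt s hline
  have hcont : Continuous fun s : ℝ => fderiv ℝ v (x + s • n) n := by fun_prop
  have hftc := intervalIntegral.integral_eq_sub_of_hasDerivAt (a := 0) (b := t)
    (fun s _ => hder s) (hcont.intervalIntegrable _ _)
  simp only [hzero, zero_smul, add_zero, zero_sub] at hftc
  calc ‖v x‖ₑ = ‖∫ s in 0..t, fderiv ℝ v (x + s • n) n‖ₑ := by rw [hftc, enorm_neg]
    _ ≤ ∫⁻ s in Set.Ioc 0 t, ‖fderiv ℝ v (x + s • n) n‖ₑ := by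
        rw [intervalIntegral.integral_of_le ht]
        exact enorm_integral_le_lintegral_enorm _
    _ = ∫⁻ s in Set.Ico 0 t, ‖fderiv ℝ v (x + s • n) n‖ₑ :=
        (setLIntegral_congr Ico_ae_eq_Ioc).symm
    _ ≤ ∫⁻ s in Set.Ico 0 t, ‖fderiv ℝ v (x + s • n)‖ₑ := by
        refine lintegral_mono fun s => enorm_le_iff_norm_le.2 ?_
        simpa [hn] using (fderiv ℝ v (x + s • n)).le_opNorm n

variable [MeasurableSpace E] [BorelSpace E] {μ : Measure E} [μ.IsAddRightInvariant]
  [SFinite μ] [SecondCountableTopology E]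

lemma setLIntegral_enorm_le_of_segments (hv : ContDiff ℝ 1 v) {A : Set E} (hA : MeasurableSet A)
    (hn : ‖n‖ = 1) {R : ℝ} {t : E → ℝ} (ht : ∀ x ∈ A, t x ∈ Set.Icc 0 R)
    (hzero : ∀ x ∈ A, v (x + t x • n) = 0)
    (hseg : ∀ x ∈ A, ∀ s ∈ Set.Ico 0 (t x), x + s • n ∈ A) :
    ∫⁻ x in A, ‖v x‖ₑ ∂μ ≤ ENNReal.ofReal R * ∫⁻ x in A, ‖fderiv ℝ v x‖ₑ ∂μ := by
  set f : E → ENNReal := A.indicator fun x => ‖fderiv ℝ v x‖ₑ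
  have hfm : Measurable f := (hv.continuous_fderiv (by norm_num)).enorm.measurable.indicator hA
  have hpt : ∀ x ∈ A, ‖v x‖ₑ ≤ ∫⁻ s in Set.Ico 0 R, f (x + s • n) := fun x hx =>
    calc ‖v x‖ₑ ≤ ∫⁻ s in Set.Ico 0 (t x), ‖fderiv ℝ v (x + s • n)‖ₑ :=
          enorm_le_lintegral_enorm_fderiv_of_segment hv hn (ht x hx).1 (hzero x hx)
      _ = ∫⁻ s in Set.Ico 0 (t x), f (x + s • n) :=
          setLIntegral_congr_fun measurableSet_Ico fun s hs =>
            (Set.indicator_of_mem (hseg x hx s hs) fun y => ‖fderiv ℝ v y‖ₑ).symm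
      _ ≤ ∫⁻ s in Set.Ico 0 R, f (x + s • n) :=
          lintegral_mono_set (Set.Ico_subset_Ico_right (ht x hx).2)
  calc ∫⁻ x in A, ‖v x‖ₑ ∂μ ≤ ∫⁻ x in A, (∫⁻ s in Set.Ico 0 R, f (x + s • n)) ∂μ :=
        setLIntegral_mono' hA hpt
    _ ≤ ∫⁻ x, (∫⁻ s in Set.Ico 0 R, f (x + s • n)) ∂μ := setLIntegral_le_lintegral _ _
    _ = ∫⁻ s in Set.Ico 0 R, ∫⁻ x, f (x + s • n) ∂μ :=
        lintegral_lintegral_swap (hfm.comp (by fun_prop)).aemeasurable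
    _ = ENNReal.ofReal R * ∫⁻ x in A, ‖fderiv ℝ v x‖ₑ ∂μ := by
        simp_rw [lintegral_add_right_eq_self f]
        rw [lintegral_const, Measure.restrict_apply_univ, Real.volume_Ico, sub_zero,
          lintegral_indicator hA, mul_comm]

end Segments

variable {E : Type*} [NormedAddCommGroup E] [InnerProductSpace ℝ E] [FiniteDimensional ℝ E]
  [MeasurableSpace E] [BorelSpace E] {v : E → ℝ}

-- Inside the cell of a facet, `v` is controlled along the segments orthogonal to that facet.
lemma lintegral_enorm_le_of_openPolyhedron {μ : Measure E} [SFinite μ] [μ.IsAddRightInvariant]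
    {ι : Type*} [LinearOrder ι] [Finite ι] [Nonempty ι] {n : ι → E} {c : ι → ℝ}
    (hn : ∀ i, ‖n i‖ = 1) {R : ℝ}
    (hR : ∀ x ∈ openPolyhedron n c, ∃ i, slack n c i x ≤ R) (hv : ContDiff ℝ 1 v)
    (hvs : Function.support v ⊆ openPolyhedron n c) :
    ∫⁻ x, ‖v x‖ₑ ∂μ ≤ ENNReal.ofReal R * ∫⁻ x, ‖fderiv ℝ v x‖ₑ ∂μ := by
  have hzero : ∀ x i, slack n c i x ≤ 0 → v x = 0 := fun x i hi => by
    by_contra h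
    exact (hvs h i).not_ge hi
  have hcell : ∀ i, ∫⁻ x in facetCell n c i, ‖v x‖ₑ ∂μ ≤
      ENNReal.ofReal R * ∫⁻ x in facetCell n c i, ‖fderiv ℝ v x‖ₑ ∂μ := fun i =>
    setLIntegral_enorm_le_of_segments hv (measurableSet_facetCell i) (hn i) (t := slack n c i)
      (fun x hx => ⟨(hx.1 i).le, (hR x hx.1).elim fun j => (slack_le_of_mem_facetCell hx j).trans⟩)
      (fun x _ => hzero _ i (by simp [slack_add_smul, hn]))
      fun x hx s hs => add_smul_mem_facetCell hn hx hs.1 hs.2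
  have hsum : ∀ f : E → ENNReal, ∫⁻ x in openPolyhedron n c, f x ∂μ =
      ∑' i, ∫⁻ x in facetCell n c i, f x ∂μ := fun f => by
    rw [← iUnion_facetCell, lintegral_iUnion measurableSet_facetCell pairwise_disjoint_facetCell]
  calc ∫⁻ x, ‖v x‖ₑ ∂μ = ∫⁻ x in openPolyhedron n c, ‖v x‖ₑ ∂μ :=
        (setLIntegral_eq_of_support_subset (by simpa [Function.support] using hvs)).symm
    _ = ∑' i, ∫⁻ x in facetCell n c i, ‖v x‖ₑ ∂μ := hsum _
    _ ≤ ∑' i, ENNReal.ofReal R * ∫⁻ x in facetCell n c i, ‖fderiv ℝ v x‖ₑ ∂μ :=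
        ENNReal.tsum_le_tsum hcell
    _ = ENNReal.ofReal R * ∫⁻ x in openPolyhedron n c, ‖fderiv ℝ v x‖ₑ ∂μ := by
        rw [ENNReal.tsum_mul_left, hsum]
    _ ≤ ENNReal.ofReal R * ∫⁻ x, ‖fderiv ℝ v x‖ₑ ∂μ := by
        gcongr
        exact Measure.restrict_le_self

lemma integral_abs_le_inradius_mul {Ω : Set E} (hΩ : IsOpen Ω) (hΩb : Bornology.IsBounded Ω)
    (hΩc : Convex ℝ Ω) (hfr : (frontier Ω).Nonempty) {R : ℝ}
    (hR : ∀ x ∈ Ω, Metric.infDist x (frontier Ω) ≤ R) (hv : ContDiff ℝ 1 v)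
    (hvc : HasCompactSupport v) (hvs : tsupport v ⊆ Ω) :
    ∫ x, |v x| ≤ R * ∫ x, ‖fderiv ℝ v x‖ := by
  obtain ⟨z, hz⟩ := hfr
  have hR0 : 0 ≤ R := by
    obtain ⟨x, hx⟩ := closure_nonempty_iff.1 ⟨z, frontier_subset_closure hz⟩
    exact Metric.infDist_nonneg.trans (hR x hx)
  rcases (tsupport v).eq_empty_or_nonempty with h0 | hne
  · simp [tsupport_eq_empty_iff.1 h0]
  obtain ⟨K, hK, hKc, hvK, hKΩ⟩ := exists_isCompact_convex_between hΩ hΩc hvc hvs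
  obtain ⟨m, n, c, hn, hKP, hPΩ⟩ :=
    exists_openPolyhedron_between hΩ hΩb hK hKc (hne.mono hvK) hKΩ
  have hm : Nonempty (Fin m) := by
    by_contra hm
    refine (Set.disjoint_iff_inter_eq_empty.2 hΩ.inter_frontier_eq).notMem_of_mem_left (hPΩ ?_) hz
    exact fun i => (hm ⟨i⟩).elim
  have hslack : ∀ x ∈ openPolyhedron n c, ∃ i, slack n c i x ≤ R := fun x hx => by
    obtain ⟨i, hi⟩ := Finite.exists_min fun j => slack n c j x
    refine ⟨i, le_trans ?_ (hR x (hPΩ hx))⟩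
    exact le_infDist_frontier hΩ ⟨z, hz⟩ ((ball_subset_openPolyhedron hn hi).trans hPΩ)
  have h := lintegral_enorm_le_of_openPolyhedron (μ := volume) hn hslack hv
    ((subset_tsupport v).trans (hvK.trans hKP))
  have hvi : Integrable v := hv.continuous.integrable_of_hasCompactSupport hvc
  have hdi : Integrable (fderiv ℝ v) :=
    (hv.continuous_fderiv (by norm_num)).integrable_of_hasCompactSupport (hvc.fderiv ℝ)
  have := ENNReal.toReal_mono (ENNReal.mul_ne_top ENNReal.ofReal_ne_top hdi.2.ne) h
  rwa [ENNReal.toReal_mul, ENNReal.toReal_ofReal hR0, ← integral_norm_eq_lintegral_enorm hvi.1,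
    ← integral_norm_eq_lintegral_enorm hdi.1] at this

end Poincare

section UniformConvexity

variable {E : Type*} [NormedAddCommGroup E] [NormedSpace ℝ E] {p ε : ℝ}

/-- The defect of midpoint convexity of the function `‖·‖ ^ p` on the segment from `a` to `b`. -/
noncomputable def midpointDefect (p : ℝ) (a b : E) : ℝ :=
  ‖a‖ ^ p + ‖b‖ ^ p - 2 * ‖(2⁻¹ : ℝ) • (a + b)‖ ^ p

lemma norm_half_smul_add_le (a b : E) : ‖(2⁻¹ : ℝ) • (a + b)‖ ≤ 2⁻¹ * ‖a‖ + 2⁻¹ * ‖b‖ := by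
  rw [norm_smul, Real.norm_of_nonneg (by norm_num), ← mul_add]
  gcongr
  exact norm_add_le a b

lemma midpointDefect_nonneg (hp : 1 ≤ p) (a b : E) : 0 ≤ midpointDefect p a b := by
  have hnorm := Real.rpow_le_rpow (norm_nonneg _) (norm_half_smul_add_le a b) (by linarith)
  have hconv := (convexOn_rpow hp).2 (norm_nonneg a) (norm_nonneg b)
    (by norm_num : (0 : ℝ) ≤ 2⁻¹) (by norm_num : (0 : ℝ) ≤ 2⁻¹) (by norm_num)
  simp only [smul_eq_mul] at hconv
  rw [midpointDefect]
  linarith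

lemma midpointDefect_pos [StrictConvexSpace ℝ E] (hp : 1 < p) {a b : E} (hab : a ≠ b) :
    0 < midpointDefect p a b := by
  have hp0 : 0 < p := by linarith
  rw [midpointDefect]
  by_cases hn : ‖a‖ = ‖b‖
  · have hlt : ‖(2⁻¹ : ℝ) • (a + b)‖ < ‖b‖ := by
      rw [smul_add]
      exact norm_combo_lt_of_ne hn.le le_rfl hab (by norm_num) (by norm_num) (by norm_num)
    have := Real.rpow_lt_rpow (norm_nonneg _) hlt hp0
    rw [hn]
    linarith
  · have hnorm := Real.rpow_le_rpow (norm_nonneg _) (norm_half_smul_add_le a b) hp0.le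
    have hconv := (strictConvexOn_rpow hp).2 (norm_nonneg a) (norm_nonneg b) hn
      (by norm_num : (0 : ℝ) < 2⁻¹) (by norm_num : (0 : ℝ) < 2⁻¹) (by norm_num)
    simp only [smul_eq_mul] at hconv
    linarith

lemma continuous_midpointDefect (hp : 0 ≤ p) :
    Continuous fun z : E × E => midpointDefect p z.1 z.2 := by
  have hrpow : Continuous fun a : E => ‖a‖ ^ p := continuous_norm.rpow_const fun _ => .inr hp
  exact ((hrpow.comp continuous_fst).add (hrpow.comp continuous_snd)).sub
    (continuous_const.mul (hrpow.comp ((continuous_fst.add continuous_snd).const_smul _)))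

lemma norm_smul_rpow (c : ℝ) (a : E) : ‖c • a‖ ^ p = |c| ^ p * ‖a‖ ^ p := by
  rw [norm_smul, Real.norm_eq_abs, Real.mul_rpow (abs_nonneg c) (norm_nonneg a)]

lemma midpointDefect_smul (c : ℝ) (a b : E) :
    midpointDefect p (c • a) (c • b) = |c| ^ p * midpointDefect p a b := by
  simp only [midpointDefect, ← smul_add, smul_comm (2⁻¹ : ℝ) c, norm_smul_rpow c]
  ring

lemma exists_le_midpointDefect_of_norm_eq_one [FiniteDimensional ℝ E] [StrictConvexSpace ℝ E]
    (hp : 1 < p) (hε : 0 < ε) :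
    ∃ m, 0 < m ∧ ∀ a b : E, ‖(a, b)‖ = 1 → ε ≤ ‖a - b‖ ^ p → m ≤ midpointDefect p a b := by
  have hp0 : 0 < p := by linarith
  have hdist : Continuous fun z : E × E => ‖z.1 - z.2‖ ^ p :=
    (continuous_fst.sub continuous_snd).norm.rpow_const fun _ => .inr hp0.le
  set S := Metric.sphere (0 : E × E) 1 ∩ {z | ε ≤ ‖z.1 - z.2‖ ^ p}
  have hS : IsCompact S := (isCompact_sphere _ _).inter_right (isClosed_le continuous_const hdist)
  have mem_S : ∀ a b : E, ‖(a, b)‖ = 1 → ε ≤ ‖a - b‖ ^ p → (a, b) ∈ S := fun a b hab hle =>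
    ⟨by simpa using hab, hle⟩
  obtain hempty | hne := S.eq_empty_or_nonempty
  · exact ⟨1, one_pos, fun a b hab hle => absurd (hempty ▸ mem_S a b hab hle) (Set.notMem_empty _)⟩
  · obtain ⟨z, hz, hmin⟩ := hS.exists_isMinOn hne (continuous_midpointDefect hp0.le).continuousOn
    refine ⟨midpointDefect p z.1 z.2, midpointDefect_pos hp fun h => ?_,
      fun a b hab hle => hmin (mem_S a b hab hle)⟩
    have hz2 : ε ≤ ‖z.1 - z.2‖ ^ p := hz.2
    rw [h, sub_self, norm_zero, Real.zero_rpow hp0.ne'] at hz2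
    linarith

lemma norm_sub_rpow_le_of_norm_eq_one {m : ℝ} (hp : 1 ≤ p) (hm : 0 < m) (hε : 0 ≤ ε) {a b : E}
    (hab : ‖(a, b)‖ = 1) (h : ε ≤ ‖a - b‖ ^ p → m ≤ midpointDefect p a b) :
    ‖a - b‖ ^ p ≤ 2 ^ p / m * midpointDefect p a b + ε * (‖a‖ ^ p + ‖b‖ ^ p) := by
  have hdefect := midpointDefect_nonneg hp a b
  obtain hfar | hnear := le_total ε (‖a - b‖ ^ p)
  · have hle : ‖a - b‖ ≤ 2 := by
      linarith [norm_sub_le a b, norm_fst_le (a, b), norm_snd_le (a, b)]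
    calc ‖a - b‖ ^ p ≤ 2 ^ p / m * m := by
          rw [div_mul_cancel₀ _ hm.ne']
          exact Real.rpow_le_rpow (norm_nonneg _) hle (by linarith)
      _ ≤ 2 ^ p / m * midpointDefect p a b := by gcongr; exact h hfar
      _ ≤ _ := le_add_of_nonneg_right (by positivity)
  · have hone : 1 ≤ ‖a‖ ^ p + ‖b‖ ^ p := by
      rw [Prod.norm_mk] at hab
      obtain h | h := max_choice ‖a‖ ‖b‖ <;> rw [← h, hab, Real.one_rpow]
      · exact le_add_of_nonneg_right (by positivity)
      · exact le_add_of_nonneg_left (by positivity)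
    calc ‖a - b‖ ^ p ≤ ε * (‖a‖ ^ p + ‖b‖ ^ p) := hnear.trans (le_mul_of_one_le_right hε hone)
      _ ≤ _ := le_add_of_nonneg_left (by positivity)

-- Compactness gives the estimate on the unit sphere of `E × E`; both sides are homogeneous.
lemma exists_norm_sub_rpow_le [FiniteDimensional ℝ E] [StrictConvexSpace ℝ E] (hp : 1 < p)
    (hε : 0 < ε) : ∃ C, 0 ≤ C ∧ ∀ a b : E,
      ‖a - b‖ ^ p ≤ C * midpointDefect p a b + ε * (‖a‖ ^ p + ‖b‖ ^ p) := by
  obtain ⟨m, hm, hmin⟩ := exists_le_midpointDefect_of_norm_eq_one (E := E) hp hε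
  refine ⟨2 ^ p / m, by positivity, fun a b => ?_⟩
  obtain h0 | h0 := eq_or_ne (a, b) 0
  · obtain ⟨rfl, rfl⟩ := Prod.mk_eq_zero.1 h0
    simp [midpointDefect, Real.zero_rpow (by linarith : p ≠ 0)]
  · set c := ‖(a, b)‖⁻¹
    have hc : 0 < c := inv_pos.2 (norm_pos_iff.2 h0)
    have hunit : ‖(c • a, c • b)‖ = 1 := by
      rw [← Prod.smul_mk, norm_smul, Real.norm_of_nonneg hc.le,
        inv_mul_cancel₀ (norm_ne_zero_iff.2 h0)]
    have h := norm_sub_rpow_le_of_norm_eq_one hp.le hm hε.le hunit (hmin _ _ hunit)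
    rw [← smul_sub, norm_smul_rpow, norm_smul_rpow, norm_smul_rpow, midpointDefect_smul] at h
    refine le_of_mul_le_mul_left ?_ (by positivity : 0 < |c| ^ p)
    linarith

end UniformConvexity

section LpNorm

variable {α ι F F' : Type*} [MeasurableSpace α] {μ : Measure α} [NormedAddCommGroup F]
  [NormedAddCommGroup F'] {p : ℝ} {q : ENNReal} {l : Filter ι}

lemma integrable_norm_rpow (hp : 0 < p) {f : α → F} (hf : MemLp f (.ofReal p) μ) :
    Integrable (fun x => ‖f x‖ ^ p) μ := by
  have := hf.integrable_norm_rpow (ENNReal.ofReal_pos.2 hp).ne' ENNReal.ofReal_ne_top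
  rwa [ENNReal.toReal_ofReal hp.le] at this

lemma integral_norm_rpow_nonneg (f : α → F) : 0 ≤ ∫ x, ‖f x‖ ^ p ∂μ :=
  integral_nonneg fun _ => Real.rpow_nonneg (norm_nonneg _) _

lemma lpNorm_eq_integral_norm_rpow (hp : 0 < p) {f : α → F} (hf : AEStronglyMeasurable f μ) :
    lpNorm f (.ofReal p) μ = (∫ x, ‖f x‖ ^ p ∂μ) ^ (1 / p) := by
  rw [lpNorm_eq_integral_norm_rpow_toReal (ENNReal.ofReal_pos.2 hp).ne' ENNReal.ofReal_ne_top hf,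
    ENNReal.toReal_ofReal hp.le, one_div]

lemma lpNorm_rpow (hp : 0 < p) {f : α → F} (hf : AEStronglyMeasurable f μ) :
    lpNorm f (.ofReal p) μ ^ p = ∫ x, ‖f x‖ ^ p ∂μ := by
  rw [lpNorm_eq_integral_norm_rpow hp hf, ← Real.rpow_mul (integral_norm_rpow_nonneg f),
    one_div_mul_cancel hp.ne', Real.rpow_one]

lemma tendsto_lpNorm_iff_tendsto_eLpNorm {f : ι → α → F} (hf : ∀ i, MemLp (f i) q μ) :
    Tendsto (fun i => lpNorm (f i) q μ) l (𝓝 0) ↔ Tendsto (fun i => eLpNorm (f i) q μ) l (𝓝 0) := by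
  rw [← ENNReal.tendsto_toReal_zero_iff fun i => (hf i).eLpNorm_ne_top]
  simp only [toReal_eLpNorm (hf _).aestronglyMeasurable]

lemma tendsto_lpNorm (hq : 1 ≤ q) {f : ι → α → F} {g : α → F} (hf : ∀ i, MemLp (f i) q μ)
    (hg : MemLp g q μ) (h : Tendsto (fun i => lpNorm (f i - g) q μ) l (𝓝 0)) :
    Tendsto (fun i => lpNorm (f i) q μ) l (𝓝 (lpNorm g q μ)) := by
  rw [tendsto_iff_norm_sub_tendsto_zero]
  refine squeeze_zero (fun _ => norm_nonneg _) (fun i => abs_sub_le_iff.2 ⟨?_, ?_⟩) h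
  · exact sub_le_iff_le_add'.2 (lpNorm_le_lpNorm_add_lpNorm_sub' hg hq)
  · exact sub_le_iff_le_add'.2 (lpNorm_le_lpNorm_add_lpNorm_sub (hf i) hq)

lemma exists_tendsto_lpNorm_of_cauchy [CompleteSpace F] (hq : 1 ≤ q) {f : ℕ → α → F}
    (hf : ∀ n, MemLp (f n) q μ)
    (h : Tendsto (fun n : ℕ × ℕ => lpNorm (f n.1 - f n.2) q μ) atTop (𝓝 0)) :
    ∃ g, MemLp g q μ ∧ Tendsto (fun n => lpNorm (f n - g) q μ) atTop (𝓝 0) := by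
  have : Fact (1 ≤ q) := ⟨hq⟩
  have hdist : ∀ {u v : α → F} (hu : MemLp u q μ) (hv : MemLp v q μ),
      dist (hu.toLp u) (hv.toLp v) = lpNorm (u - v) q μ := fun hu hv => by
    rw [dist_eq_norm, ← MemLp.toLp_sub, Lp.norm_toLp, toReal_eLpNorm (hu.sub hv).1]
  have hcauchy : CauchySeq fun n => (hf n).toLp (f n) :=
    cauchySeq_iff_tendsto_dist_atTop_0.2 (h.congr fun n => (hdist (hf n.1) (hf n.2)).symm)
  obtain ⟨g, hg⟩ := cauchySeq_tendsto_of_complete hcauchy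
  refine ⟨g, Lp.memLp g, ?_⟩
  rw [← Lp.toLp_coeFn g (Lp.memLp g), tendsto_iff_dist_tendsto_zero] at hg
  exact hg.congr fun n => hdist (hf n) (Lp.memLp g)

lemma integral_norm_le_lpNorm [IsFiniteMeasure μ] (hp : 1 ≤ p) {f : α → F}
    (hf : MemLp f (.ofReal p) μ) :
    ∫ x, ‖f x‖ ∂μ ≤ μ.real Set.univ ^ (1 - 1 / p) * lpNorm f (.ofReal p) μ := by
  have h := eLpNorm_le_eLpNorm_mul_rpow_measure_univ (ENNReal.one_le_ofReal.2 hp) hf.1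
  rw [ENNReal.toReal_one, ENNReal.toReal_ofReal (by linarith), one_div_one] at h
  have hexp : 0 ≤ 1 - 1 / p := sub_nonneg.2 ((div_le_one (by linarith)).2 hp)
  have htop := ENNReal.rpow_ne_top_of_nonneg hexp (measure_ne_top μ Set.univ)
  have := ENNReal.toReal_mono (ENNReal.mul_ne_top hf.eLpNorm_ne_top htop) h
  rwa [ENNReal.toReal_mul, ← ENNReal.toReal_rpow, toReal_eLpNorm hf.1, toReal_eLpNorm hf.1,
    lpNorm_one_eq_integral_norm hf.1, mul_comm] at this

lemma tendsto_integral_norm_sub [IsFiniteMeasure μ] (hp : 1 ≤ p) {f : ι → α → F} {g : α → F}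
    (hf : ∀ i, MemLp (f i) (.ofReal p) μ) (hg : MemLp g (.ofReal p) μ)
    (h : Tendsto (fun i => lpNorm (f i - g) (.ofReal p) μ) l (𝓝 0)) :
    Tendsto (fun i => ∫ x, ‖f i x - g x‖ ∂μ) l (𝓝 0) := by
  have hmul := h.const_mul (μ.real Set.univ ^ (1 - 1 / p))
  rw [mul_zero] at hmul
  exact squeeze_zero (fun _ => integral_nonneg fun _ => norm_nonneg _)
    (fun i => integral_norm_le_lpNorm hp ((hf i).sub hg)) hmul

lemma tendsto_integral_of_tendsto_integral_norm_sub [NormedSpace ℝ F] {f : ι → α → F} {g : α → F}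
    (hf : ∀ i, Integrable (f i) μ) (hg : Integrable g μ)
    (h : Tendsto (fun i => ∫ x, ‖f i x - g x‖ ∂μ) l (𝓝 0)) :
    Tendsto (fun i => ∫ x, f i x ∂μ) l (𝓝 (∫ x, g x ∂μ)) := by
  rw [tendsto_iff_norm_sub_tendsto_zero]
  refine squeeze_zero (fun _ => norm_nonneg _) (fun i => ?_) h
  rw [← integral_sub (hf i) hg]
  exact norm_integral_le_integral_norm _

lemma tendsto_integral_bilin_of_bounded {F'' : Type*} [NormedAddCommGroup F''] [NormedSpace ℝ F]
    [NormedSpace ℝ F'] [NormedSpace ℝ F''] (B : F →L[ℝ] F' →L[ℝ] F'') {f : ι → α → F} {g : α → F}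
    {k : α → F'} {C : ℝ} (hf : ∀ i, Integrable (f i) μ) (hg : Integrable g μ)
    (hk : AEStronglyMeasurable k μ) (hC : ∀ x, ‖k x‖ ≤ C)
    (h : Tendsto (fun i => ∫ x, ‖f i x - g x‖ ∂μ) l (𝓝 0)) :
    Tendsto (fun i => ∫ x, B (f i x) (k x) ∂μ) l (𝓝 (∫ x, B (g x) (k x) ∂μ)) := by
  have hle : ∀ (v : F) x, ‖B v (k x)‖ ≤ ‖B‖ * C * ‖v‖ := fun v x =>
    calc ‖B v (k x)‖ ≤ ‖B‖ * ‖v‖ * ‖k x‖ := B.le_opNorm₂ _ _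
      _ ≤ ‖B‖ * ‖v‖ * C := by gcongr; exact hC x
      _ = ‖B‖ * C * ‖v‖ := by ring
  have hInt : ∀ {v : α → F}, Integrable v μ → Integrable (fun x => B (v x) (k x)) μ := fun hv =>
    (hv.norm.const_mul (‖B‖ * C)).mono' (B.aestronglyMeasurable_comp₂ hv.1 hk)
      (Eventually.of_forall fun x => hle _ x)
  refine tendsto_integral_of_tendsto_integral_norm_sub (fun i => hInt (hf i)) (hInt hg) ?_
  refine squeeze_zero (fun _ => integral_nonneg fun _ => norm_nonneg _) (fun i => ?_)
    (by simpa only [mul_zero] using h.const_mul (‖B‖ * C))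
  rw [← integral_const_mul]
  refine integral_mono ((hInt (hf i)).sub (hInt hg)).norm
    (((hf i).sub hg).norm.const_mul _) fun x => ?_
  simpa only [map_sub, sub_apply] using hle (f i x - g x) x

lemma memLp_norm_rpow_sub_one (hp : 1 < p) {f : α → F} (hf : MemLp f (.ofReal p) μ) :
    MemLp (fun x => ‖f x‖ ^ (p - 1)) (.ofReal (p / (p - 1))) μ := by
  have := hf.norm_rpow_div (ENNReal.ofReal (p - 1))
  rwa [ENNReal.toReal_ofReal (by linarith), ← ENNReal.ofReal_div_of_pos (by linarith)] at this

lemma integrable_norm_rpow_mul_norm (hp : 1 < p) {f : α → F} {g : α → F'}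
    (hf : MemLp f (.ofReal p) μ) (hg : MemLp g (.ofReal p) μ) :
    Integrable (fun x => ‖f x‖ ^ (p - 1) * ‖g x‖) μ :=
  have : ENNReal.HolderConjugate (.ofReal (p / (p - 1))) (.ofReal p) :=
    (Real.HolderConjugate.conjExponent hp).symm.ennrealOfReal
  (memLp_norm_rpow_sub_one hp hf).integrable_mul hg.norm

lemma integral_norm_rpow_mul_norm_le (hp : 1 < p) {f : α → F} {g : α → F'}
    (hf : MemLp f (.ofReal p) μ) (hg : MemLp g (.ofReal p) μ) :
    ∫ x, ‖f x‖ ^ (p - 1) * ‖g x‖ ∂μ ≤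
      lpNorm f (.ofReal p) μ ^ (p - 1) * lpNorm g (.ofReal p) μ := by
  have hp0 : 0 < p := by linarith
  have hp1 : p - 1 ≠ 0 := by linarith
  have hpow : ∀ x, (‖f x‖ ^ (p - 1)) ^ (p / (p - 1)) = ‖f x‖ ^ p := fun x => by
    rw [← Real.rpow_mul (norm_nonneg _), mul_div_cancel₀ _ hp1]
  have holder := integral_mul_le_Lp_mul_Lq_of_nonneg (Real.HolderConjugate.conjExponent hp).symm
    (Eventually.of_forall fun x => Real.rpow_nonneg (norm_nonneg (f x)) (p - 1))
    (Eventually.of_forall fun x => norm_nonneg (g x)) (memLp_norm_rpow_sub_one hp hf) hg.norm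
  simp only [Real.conjExponent, hpow] at holder
  refine holder.trans_eq ?_
  rw [lpNorm_eq_integral_norm_rpow hp0 hf.1, lpNorm_eq_integral_norm_rpow hp0 hg.1,
    ← Real.rpow_mul (integral_norm_rpow_nonneg f)]
  congr 2
  field_simp

end LpNorm

section InnerProduct

variable {α G : Type*} [MeasurableSpace α] {μ : Measure α} [NormedAddCommGroup G]
  [InnerProductSpace ℝ G] {p : ℝ}

lemma norm_rpow_mul_inner_le (a b : G) :
    ‖‖a‖ ^ (p - 2) * inner ℝ a b‖ ≤ ‖a‖ ^ (p - 1) * ‖b‖ := by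
  obtain rfl | ha := eq_or_ne a 0
  · simp only [inner_zero_left, norm_zero, mul_zero]
    positivity
  · calc ‖‖a‖ ^ (p - 2) * inner ℝ a b‖ ≤ ‖a‖ ^ (p - 2) * (‖a‖ * ‖b‖) := by
          rw [norm_mul, Real.norm_of_nonneg (Real.rpow_nonneg (norm_nonneg a) _)]
          gcongr
          exact norm_inner_le_norm a b
      _ = ‖a‖ ^ (p - 1) * ‖b‖ := by
          rw [← mul_assoc, ← Real.rpow_add_one (norm_ne_zero_iff.2 ha)]
          ring_nf

lemma norm_rpow_mul_inner_self (hp : p ≠ 0) (a : G) : ‖a‖ ^ (p - 2) * inner ℝ a a = ‖a‖ ^ p := by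
  obtain rfl | ha := eq_or_ne a 0
  · rw [inner_zero_left, mul_zero, norm_zero, Real.zero_rpow hp]
  · rw [real_inner_self_eq_norm_sq, ← Real.rpow_natCast, ← Real.rpow_add (norm_pos_iff.2 ha)]
    norm_num

lemma norm_smul_rpow_mul_inner {c : ℝ} (hc : 0 < c) (a b : G) :
    ‖c • a‖ ^ (p - 2) * inner ℝ (c • a) b = c ^ (p - 1) * (‖a‖ ^ (p - 2) * inner ℝ a b) := by
  rw [norm_smul_rpow, abs_of_pos hc, real_inner_smul_left,
    show p - 1 = p - 2 + 1 by ring, Real.rpow_add_one hc.ne']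
  ring

lemma integrable_norm_rpow_mul_inner (hp : 1 < p) {f g : α → G} (hf : MemLp f (.ofReal p) μ)
    (hg : MemLp g (.ofReal p) μ) :
    Integrable (fun x => ‖f x‖ ^ (p - 2) * inner ℝ (f x) (g x)) μ :=
  (integrable_norm_rpow_mul_norm hp hf hg).mono'
    ((hf.1.norm.aemeasurable.pow_const _).aestronglyMeasurable.mul (hf.1.inner hg.1))
    (Eventually.of_forall fun _ => norm_rpow_mul_inner_le _ _)

lemma abs_integral_norm_rpow_mul_inner_le (hp : 1 < p) {f g : α → G} (hf : MemLp f (.ofReal p) μ)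
    (hg : MemLp g (.ofReal p) μ) :
    |∫ x, ‖f x‖ ^ (p - 2) * inner ℝ (f x) (g x) ∂μ| ≤
      lpNorm f (.ofReal p) μ ^ (p - 1) * lpNorm g (.ofReal p) μ :=
  (norm_integral_le_of_norm_le (integrable_norm_rpow_mul_norm hp hf hg)
    (Eventually.of_forall fun _ => norm_rpow_mul_inner_le _ _)).trans
    (integral_norm_rpow_mul_norm_le hp hf hg)

lemma tendsto_integral_norm_rpow_mul_inner {ι : Type*} {l : Filter ι} (hp : 1 < p) {f g : α → G}
    {g' : ι → α → G} (hf : MemLp f (.ofReal p) μ) (hg : MemLp g (.ofReal p) μ)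
    (hg' : ∀ i, MemLp (g' i) (.ofReal p) μ)
    (h : Tendsto (fun i => lpNorm (g' i - g) (.ofReal p) μ) l (𝓝 0)) :
    Tendsto (fun i => ∫ x, ‖f x‖ ^ (p - 2) * inner ℝ (f x) (g' i x) ∂μ) l
      (𝓝 (∫ x, ‖f x‖ ^ (p - 2) * inner ℝ (f x) (g x) ∂μ)) := by
  rw [tendsto_iff_norm_sub_tendsto_zero]
  refine squeeze_zero (fun _ => norm_nonneg _) (fun i => ?_)
    (by simpa only [mul_zero] using h.const_mul (lpNorm f (.ofReal p) μ ^ (p - 1)))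
  rw [← integral_sub (integrable_norm_rpow_mul_inner hp hf (hg' i))
    (integrable_norm_rpow_mul_inner hp hf hg)]
  simp only [← mul_sub, ← inner_sub_right]
  exact abs_integral_norm_rpow_mul_inner_le hp hf ((hg' i).sub hg)

lemma integral_norm_sub_rpow_le {f g : α → G} {C ε K : ℝ} (hp : 1 < p) (hC0 : 0 ≤ C)
    (hC : ∀ a b : G, ‖a - b‖ ^ p ≤ C * midpointDefect p a b + ε * (‖a‖ ^ p + ‖b‖ ^ p))
    (hf : MemLp f (.ofReal p) μ) (hg : MemLp g (.ofReal p) μ)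
    (hK : K ≤ ∫ x, ‖(2⁻¹ : ℝ) • (f x + g x)‖ ^ p ∂μ) :
    ∫ x, ‖f x - g x‖ ^ p ∂μ ≤
      C * ((∫ x, ‖f x‖ ^ p ∂μ) + (∫ x, ‖g x‖ ^ p ∂μ) - 2 * K) +
        ε * ((∫ x, ‖f x‖ ^ p ∂μ) + ∫ x, ‖g x‖ ^ p ∂μ) := by
  have hp0 : 0 < p := by linarith
  have hfi := integrable_norm_rpow hp0 hf
  have hgi := integrable_norm_rpow hp0 hg
  have hmid : Integrable (fun x => ‖(2⁻¹ : ℝ) • (f x + g x)‖ ^ p) μ :=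
    integrable_norm_rpow hp0 ((hf.add hg).const_smul (2⁻¹ : ℝ))
  have hadd : Integrable (fun x => ‖f x‖ ^ p + ‖g x‖ ^ p) μ := hfi.add hgi
  have hdefect : Integrable (fun x => midpointDefect p (f x) (g x)) μ :=
    hadd.sub (hmid.const_mul 2)
  calc ∫ x, ‖f x - g x‖ ^ p ∂μ
      ≤ ∫ x, C * midpointDefect p (f x) (g x) + ε * (‖f x‖ ^ p + ‖g x‖ ^ p) ∂μ :=
        integral_mono (integrable_norm_rpow hp0 (hf.sub hg))
          ((hdefect.const_mul C).add (hadd.const_mul ε)) fun x => hC (f x) (g x)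
    _ = C * ((∫ x, ‖f x‖ ^ p ∂μ) + (∫ x, ‖g x‖ ^ p ∂μ) -
          2 * ∫ x, ‖(2⁻¹ : ℝ) • (f x + g x)‖ ^ p ∂μ) +
        ε * ((∫ x, ‖f x‖ ^ p ∂μ) + ∫ x, ‖g x‖ ^ p ∂μ) := by
        rw [integral_add (hdefect.const_mul C) (hadd.const_mul ε), integral_const_mul,
          integral_const_mul, integral_add hfi hgi]
        simp only [midpointDefect]
        rw [integral_sub hadd (hmid.const_mul 2), integral_add hfi hgi, integral_const_mul]
    _ ≤ _ := by gcongr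

lemma tendsto_lpNorm_sub_of_minimizing [FiniteDimensional ℝ G] (hp : 1 < p) {f : ℕ → α → G}
    {K : ℝ} (hf : ∀ n, MemLp (f n) (.ofReal p) μ)
    (hK : Tendsto (fun n => ∫ x, ‖f n x‖ ^ p ∂μ) atTop (𝓝 K))
    (hmid : ∀ n m, K ≤ ∫ x, ‖(2⁻¹ : ℝ) • (f n x + f m x)‖ ^ p ∂μ) :
    Tendsto (fun n : ℕ × ℕ => lpNorm (f n.1 - f n.2) (.ofReal p) μ) atTop (𝓝 0) := by
  have hp0 : 0 < p := by linarith
  have hK0 : 0 ≤ K := ge_of_tendsto' hK fun n => integral_norm_rpow_nonneg _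
  have hfst : Tendsto (fun n : ℕ × ℕ => ∫ x, ‖f n.1 x‖ ^ p ∂μ) atTop (𝓝 K) := by
    rw [← prod_atTop_atTop_eq]
    exact hK.comp tendsto_fst
  have hsnd : Tendsto (fun n : ℕ × ℕ => ∫ x, ‖f n.2 x‖ ^ p ∂μ) atTop (𝓝 K) := by
    rw [← prod_atTop_atTop_eq]
    exact hK.comp tendsto_snd
  have hpow : Tendsto (fun n : ℕ × ℕ => ∫ x, ‖f n.1 x - f n.2 x‖ ^ p ∂μ) atTop (𝓝 0) := by
    refine Metric.tendsto_nhds.2 fun η hη => ?_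
    set ε := η / (2 * K + 1) with hε
    obtain ⟨C, hC0, hC⟩ := exists_norm_sub_rpow_le (E := G) hp (by positivity : 0 < ε)
    have hlim := (((hfst.add hsnd).sub_const (2 * K)).const_mul C).add
      ((hfst.add hsnd).const_mul ε)
    have hlt : C * (K + K - 2 * K) + ε * (K + K) < η := by
      rw [← two_mul, sub_self, mul_zero, zero_add, hε, div_mul_eq_mul_div,
        div_lt_iff₀ (by positivity)]
      linarith
    filter_upwards [hlim.eventually (gt_mem_nhds hlt)] with n hn
    rw [Real.dist_eq, sub_zero, abs_of_nonneg (integral_norm_rpow_nonneg _)]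
    exact (integral_norm_sub_rpow_le hp hC0 hC (hf n.1) (hf n.2) (hmid _ _)).trans_lt hn
  have hroot := hpow.rpow_const (p := 1 / p) (.inr (by positivity))
  rw [Real.zero_rpow (by positivity)] at hroot
  exact hroot.congr fun n => (lpNorm_eq_integral_norm_rpow hp0 ((hf n.1).sub (hf n.2)).1).symm

lemma hasDerivAt_norm_add_smul_rpow (hp : 1 < p) (a b : G) (t : ℝ) :
    HasDerivAt (fun t : ℝ => ‖a + t • b‖ ^ p)
      (p * (‖a + t • b‖ ^ (p - 2) * inner ℝ (a + t • b) b)) t := by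
  have hline : HasDerivAt (fun t : ℝ => a + t • b) b t := by
    simpa using ((hasDerivAt_id t).smul_const b).const_add a
  refine ((hasFDerivAt_norm_rpow (a + t • b) hp).comp_hasDerivAt t hline).congr_deriv ?_
  simp only [smul_apply, innerSL_apply_apply, smul_eq_mul, mul_assoc]

lemma norm_rpow_mul_inner_add_smul_le (hp : 1 ≤ p) (a b : G) {t : ℝ} (ht : |t| ≤ 1) :
    ‖‖a + t • b‖ ^ (p - 2) * inner ℝ (a + t • b) b‖ ≤ ‖‖a‖ + ‖b‖‖ ^ (p - 1) * ‖b‖ := by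
  refine (norm_rpow_mul_inner_le _ _).trans ?_
  gcongr
  calc ‖a + t • b‖ ≤ ‖a‖ + |t| * ‖b‖ := by
        rw [← Real.norm_eq_abs, ← norm_smul]
        exact norm_add_le _ _
    _ ≤ ‖a‖ + ‖b‖ := by
        gcongr
        exact mul_le_of_le_one_left (norm_nonneg b) ht
    _ ≤ ‖‖a‖ + ‖b‖‖ := le_abs_self _

lemma hasDerivAt_integral_norm_add_smul_rpow (hp : 1 < p) {f g : α → G}
    (hf : MemLp f (.ofReal p) μ) (hg : MemLp g (.ofReal p) μ) :
    HasDerivAt (fun t : ℝ => ∫ x, ‖f x + t • g x‖ ^ p ∂μ)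
      (p * ∫ x, ‖f x‖ ^ (p - 2) * inner ℝ (f x) (g x) ∂μ) 0 := by
  have hp0 : 0 < p := by linarith
  have hline : ∀ t : ℝ, MemLp (fun x => f x + t • g x) (.ofReal p) μ := fun t =>
    hf.add (hg.const_smul t)
  have hderiv := hasDerivAt_integral_of_dominated_loc_of_deriv_le
    (F' := fun t x => p * (‖f x + t • g x‖ ^ (p - 2) * inner ℝ (f x + t • g x) (g x)))
    (bound := fun x => p * (‖‖f x‖ + ‖g x‖‖ ^ (p - 1) * ‖g x‖))
    (Metric.ball_mem_nhds (0 : ℝ) one_pos)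
    (Eventually.of_forall fun t => (integrable_norm_rpow hp0 (hline t)).1)
    (integrable_norm_rpow hp0 (hline 0))
    ((integrable_norm_rpow_mul_inner hp (hline 0) hg).const_mul p).1
    (Eventually.of_forall fun x t ht => ?_)
    ((integrable_norm_rpow_mul_norm hp (hf.norm.add hg.norm) hg).const_mul p)
    (Eventually.of_forall fun x t _ => hasDerivAt_norm_add_smul_rpow hp (f x) (g x) t)
  · simpa only [zero_smul, add_zero, integral_const_mul] using hderiv.2
  · rw [norm_mul, Real.norm_of_nonneg hp0.le]
    gcongr
    exact norm_rpow_mul_inner_add_smul_le hp.le _ _ (mem_ball_zero_iff.1 ht).le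

end InnerProduct

namespace IsConvexDomain

variable {D : ℕ} {Ω : Set (EuclideanSpace ℝ (Fin D))}

lemma volume_ne_top (h : IsConvexDomain Ω) : volume Ω ≠ ⊤ := h.isBounded.measure_lt_top.ne

lemma volume_real_pos (h : IsConvexDomain Ω) : 0 < volume.real Ω :=
  ENNReal.toReal_pos (h.isOpen.measure_pos volume h.nonempty).ne' h.volume_ne_top

lemma isFiniteMeasure_volume_restrict (h : IsConvexDomain Ω) :
    IsFiniteMeasure (volume.restrict Ω) :=
  isFiniteMeasure_restrict.2 h.volume_ne_top

lemma integrableOn_of_continuous (h : IsConvexDomain Ω) {F : Type*} [NormedAddCommGroup F]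
    {f : EuclideanSpace ℝ (Fin D) → F} (hf : Continuous f) : IntegrableOn f Ω :=
  (hf.continuousOn.integrableOn_compact h.isBounded.isCompact_closure).mono_set subset_closure

lemma avgDist_mul_volume (h : IsConvexDomain Ω) :
    avgDist Ω * volume.real Ω = ∫ x in Ω, Metric.infDist x (frontier Ω) := by
  rw [avgDist, inv_mul_eq_div, div_mul_cancel₀ _ h.volume_real_pos.ne']

variable [NeZero D]

lemma frontier_nonempty (h : IsConvexDomain Ω) : (frontier Ω).Nonempty :=
  nonempty_frontier_iff.2 ⟨h.nonempty, fun huniv =>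
    NormedSpace.unbounded_univ ℝ (EuclideanSpace ℝ (Fin D)) (huniv ▸ h.isBounded)⟩

lemma infDist_pos (h : IsConvexDomain Ω) {x : EuclideanSpace ℝ (Fin D)} (hx : x ∈ Ω) :
    0 < Metric.infDist x (frontier Ω) :=
  infDist_frontier_pos h.isOpen h.frontier_nonempty hx

lemma avgDist_pos (h : IsConvexDomain Ω) : 0 < avgDist Ω := by
  refine mul_pos (inv_pos.2 h.volume_real_pos) ?_
  rw [setIntegral_pos_iff_support_of_nonneg_ae
    (Eventually.of_forall fun x => Metric.infDist_nonneg)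
    (h.integrableOn_of_continuous (Metric.continuous_infDist_pt _))]
  exact (h.isOpen.measure_pos volume h.nonempty).trans_le
    (measure_mono fun x hx => ⟨(h.infDist_pos hx).ne', hx⟩)

lemma infDist_le_mul_avgDist (h : IsConvexDomain Ω) {c : EuclideanSpace ℝ (Fin D)} (hc : c ∈ Ω) :
    Metric.infDist c (frontier Ω) ≤ (D + 1) * avgDist Ω := by
  have := mul_measureReal_le_setIntegral_of_concaveOn (μ := volume) h.isOpen.measurableSet
    (concaveOn_infDist_frontier h.isOpen h.convex h.frontier_nonempty)
    (fun x _ => Metric.infDist_nonneg)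
    (h.integrableOn_of_continuous (Metric.continuous_infDist_pt _)) hc
  rw [finrank_euclideanSpace_fin, ← h.avgDist_mul_volume, ← mul_assoc] at this
  exact le_of_mul_le_mul_right this h.volume_real_pos

end IsConvexDomain

section Gradient

variable {E : Type*} [NormedAddCommGroup E] [InnerProductSpace ℝ E]

lemma norm_gradient [CompleteSpace E] (φ : E → ℝ) (x : E) : ‖∇ φ x‖ = ‖fderiv ℝ φ x‖ := by
  rw [← toDual_gradient, LinearIsometryEquiv.norm_map]

lemma integral_smul_gradient_eq_neg [FiniteDimensional ℝ E] [MeasurableSpace E] [BorelSpace E]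
    {μ : Measure E} [μ.IsAddHaarMeasure] {f g : E → ℝ} (hf : Differentiable ℝ f)
    (hg : Differentiable ℝ g) (hfg : Integrable (fun x => f x * g x) μ)
    (hfg' : Integrable (fun x => f x • ∇ g x) μ) (hgf' : Integrable (fun x => g x • ∇ f x) μ) :
    ∫ x, f x • ∇ g x ∂μ = -∫ x, g x • ∇ f x ∂μ := by
  refine ext_inner_left ℝ fun w => ?_
  rw [inner_neg_right, ← integral_inner hfg', ← integral_inner hgf']
  have hinner : ∀ (v u : E → ℝ) (x : E), inner ℝ w (v x • ∇ u x) = v x * fderiv ℝ u x w :=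
    fun v u x => by rw [real_inner_smul_right, real_inner_comm, inner_gradient_left]
  have hfg'w := hfg'.const_inner w (𝕜 := ℝ)
  have hgf'w := hgf'.const_inner w (𝕜 := ℝ)
  simp only [hinner] at hfg'w hgf'w ⊢
  rw [integral_mul_fderiv_eq_neg_fderiv_mul_of_integrable (by simpa only [mul_comm] using hgf'w)
    hfg'w hfg (fun x _ => hf x) fun x _ => hg x]
  simp only [mul_comm]

end Gradient

section TestFunctions

variable {D : ℕ} {Ω : Set (EuclideanSpace ℝ (Fin D))}

namespace IsTestFunction

variable {φ ψ : EuclideanSpace ℝ (Fin D) → ℝ}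

lemma differentiable (h : IsTestFunction Ω φ) : Differentiable ℝ φ :=
  h.contDiff.differentiable (by simp)

lemma continuous_gradient (h : IsTestFunction Ω φ) : Continuous (∇ φ) :=
  (InnerProductSpace.toDual ℝ _).symm.continuous.comp (h.contDiff.continuous_fderiv (by simp))

lemma hasCompactSupport_gradient (h : IsTestFunction Ω φ) : HasCompactSupport (∇ φ) :=
  (h.hasCompactSupport.fderiv ℝ).comp_left (g := (InnerProductSpace.toDual ℝ _).symm) (map_zero _)

lemma eq_zero_of_notMem (h : IsTestFunction Ω φ) {x : EuclideanSpace ℝ (Fin D)} (hx : x ∉ Ω) :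
    φ x = 0 :=
  image_eq_zero_of_notMem_tsupport fun hx' => hx (h.tsupport_subset hx')

lemma gradient_eq_zero_of_notMem (h : IsTestFunction Ω φ) {x : EuclideanSpace ℝ (Fin D)}
    (hx : x ∉ Ω) : ∇ φ x = 0 := by
  rw [← norm_eq_zero, norm_gradient, norm_eq_zero]
  exact image_eq_zero_of_notMem_tsupport
    fun hx' => hx (h.tsupport_subset (tsupport_fderiv_subset ℝ hx'))

lemma add (h : IsTestFunction Ω φ) (h' : IsTestFunction Ω ψ) : IsTestFunction Ω (φ + ψ) :=
  ⟨h.contDiff.add h'.contDiff, h.hasCompactSupport.add h'.hasCompactSupport,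
    (tsupport_add φ ψ).trans (Set.union_subset h.tsupport_subset h'.tsupport_subset)⟩

lemma const_smul (h : IsTestFunction Ω φ) (c : ℝ) : IsTestFunction Ω (c • φ) :=
  ⟨contDiff_const.smul h.contDiff, h.hasCompactSupport.smul_left (f := fun _ => c),
    (closure_mono (Function.support_const_smul_subset c φ)).trans h.tsupport_subset⟩

lemma sub (h : IsTestFunction Ω φ) (h' : IsTestFunction Ω ψ) : IsTestFunction Ω (φ - ψ) := by
  have := h.add (h'.const_smul (-1))
  rwa [neg_one_smul, ← sub_eq_add_neg] at this

lemma gradient_add (h : IsTestFunction Ω φ) (h' : IsTestFunction Ω ψ) :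
    ∇ (φ + ψ) = ∇ φ + ∇ ψ := by
  funext x
  simp only [gradient, Pi.add_apply]
  rw [fderiv_add (h.differentiable x) (h'.differentiable x), map_add]

lemma gradient_const_smul (h : IsTestFunction Ω φ) (c : ℝ) : ∇ (c • φ) = c • ∇ φ := by
  funext x
  simp only [gradient, Pi.smul_apply]
  rw [fderiv_const_smul (h.differentiable x), map_smul]

lemma gradient_sub (h : IsTestFunction Ω φ) (h' : IsTestFunction Ω ψ) :
    ∇ (φ - ψ) = ∇ φ - ∇ ψ := by
  funext x
  simp only [gradient, Pi.sub_apply]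
  rw [fderiv_sub (h.differentiable x) (h'.differentiable x), map_sub]

lemma memLp (h : IsTestFunction Ω φ) (q : ENNReal) : MemLp φ q (volume.restrict Ω) :=
  (h.contDiff.continuous.memLp_of_hasCompactSupport h.hasCompactSupport).restrict Ω

lemma memLp_gradient (h : IsTestFunction Ω φ) (q : ENNReal) :
    MemLp (∇ φ) q (volume.restrict Ω) :=
  (h.continuous_gradient.memLp_of_hasCompactSupport h.hasCompactSupport_gradient).restrict Ω

lemma setIntegral_eq (h : IsTestFunction Ω φ) : ∫ x in Ω, φ x = ∫ x, φ x :=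
  setIntegral_eq_integral_of_forall_compl_eq_zero fun _ hx => h.eq_zero_of_notMem hx

lemma hasWeakGradient (h : IsTestFunction Ω φ) : HasWeakGradient Ω φ (∇ φ) := fun ψ hψ => by
  rw [setIntegral_eq_integral_of_forall_compl_eq_zero fun x hx => by
      rw [h.eq_zero_of_notMem hx, zero_smul],
    setIntegral_eq_integral_of_forall_compl_eq_zero fun x hx => by
      rw [hψ.eq_zero_of_notMem hx, zero_smul]]
  exact integral_smul_gradient_eq_neg h.differentiable hψ.differentiable
    ((h.contDiff.continuous.mul hψ.contDiff.continuous).integrable_of_hasCompactSupport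
      h.hasCompactSupport.mul_right)
    ((h.contDiff.continuous.smul hψ.continuous_gradient).integrable_of_hasCompactSupport
      h.hasCompactSupport.smul_right)
    ((hψ.contDiff.continuous.smul h.continuous_gradient).integrable_of_hasCompactSupport
      hψ.hasCompactSupport.smul_right)

end IsTestFunction

variable {p : ℝ} {u : EuclideanSpace ℝ (Fin D) → ℝ}
  {G : EuclideanSpace ℝ (Fin D) → EuclideanSpace ℝ (Fin D)}

lemma HasWeakGradient.of_tendsto {ι : Type*} {l : Filter ι} [l.NeBot]
    {v : ι → EuclideanSpace ℝ (Fin D) → ℝ}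
    {V : ι → EuclideanSpace ℝ (Fin D) → EuclideanSpace ℝ (Fin D)}
    (hvV : ∀ i, HasWeakGradient Ω (v i) (V i)) (hv : ∀ i, IntegrableOn (v i) Ω)
    (hV : ∀ i, IntegrableOn (V i) Ω) (hu : IntegrableOn u Ω) (hG : IntegrableOn G Ω)
    (hvu : Tendsto (fun i => ∫ x in Ω, ‖v i x - u x‖) l (𝓝 0))
    (hVG : Tendsto (fun i => ∫ x in Ω, ‖V i x - G x‖) l (𝓝 0)) : HasWeakGradient Ω u G := by
  intro ψ hψ
  obtain ⟨C, hC⟩ := hψ.contDiff.continuous.bounded_above_of_compact_support hψ.hasCompactSupport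
  obtain ⟨C', hC'⟩ :=
    hψ.continuous_gradient.bounded_above_of_compact_support hψ.hasCompactSupport_gradient
  have hleft := tendsto_integral_bilin_of_bounded (ContinuousLinearMap.lsmul ℝ ℝ) hv hu
    hψ.continuous_gradient.aestronglyMeasurable hC' hvu
  have hright := tendsto_integral_bilin_of_bounded (ContinuousLinearMap.lsmul ℝ ℝ).flip hV hG
    hψ.contDiff.continuous.aestronglyMeasurable hC hVG
  exact tendsto_nhds_unique hleft (hright.neg.congr fun i => (hvV i ψ hψ).symm)

lemma MemSobolevZero.of_tendsto [IsFiniteMeasure (volume.restrict Ω)] (hp : 1 ≤ p)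
    (hu : MemLp u (.ofReal p) (volume.restrict Ω)) (hG : MemLp G (.ofReal p) (volume.restrict Ω))
    {φ : ℕ → EuclideanSpace ℝ (Fin D) → ℝ} (hφ : ∀ n, IsTestFunction Ω (φ n))
    (hφu : Tendsto (fun n => lpNorm (φ n - u) (.ofReal p) (volume.restrict Ω)) atTop (𝓝 0))
    (hφG : Tendsto (fun n => lpNorm (∇ (φ n) - G) (.ofReal p) (volume.restrict Ω)) atTop (𝓝 0)) :
    MemSobolevZero p Ω u G := by
  have hφp := fun n => (hφ n).memLp (.ofReal p)
  have hφp' := fun n => (hφ n).memLp_gradient (.ofReal p)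
  have hq := ENNReal.one_le_ofReal.2 hp
  exact {
    memSobolev := ⟨hu, hG, .of_tendsto (fun n => (hφ n).hasWeakGradient)
      (fun n => (hφp n).integrable hq) (fun n => (hφp' n).integrable hq) (hu.integrable hq)
      (hG.integrable hq) (tendsto_integral_norm_sub hp hφp hu hφu)
      (tendsto_integral_norm_sub hp hφp' hG hφG)⟩
    approx := ⟨φ, hφ, (tendsto_lpNorm_iff_tendsto_eLpNorm fun n => (hφp n).sub hu).1 hφu,
      (tendsto_lpNorm_iff_tendsto_eLpNorm fun n => (hφp' n).sub hG).1 hφG⟩ }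

lemma MemSobolevZero.exists_tendsto_lpNorm (h : MemSobolevZero p Ω u G) :
    ∃ φ : ℕ → EuclideanSpace ℝ (Fin D) → ℝ, (∀ n, IsTestFunction Ω (φ n)) ∧
      Tendsto (fun n => lpNorm (φ n - u) (.ofReal p) (volume.restrict Ω)) atTop (𝓝 0) ∧
      Tendsto (fun n => lpNorm (∇ (φ n) - G) (.ofReal p) (volume.restrict Ω)) atTop (𝓝 0) := by
  obtain ⟨φ, hφ, hφu, hφG⟩ := h.approx
  exact ⟨φ, hφ,
    (tendsto_lpNorm_iff_tendsto_eLpNorm fun n => ((hφ n).memLp _).sub h.memSobolev.memLp).2 hφu,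
    (tendsto_lpNorm_iff_tendsto_eLpNorm
      fun n => ((hφ n).memLp_gradient _).sub h.memSobolev.memLp_grad).2 hφG⟩

end TestFunctions

section PoincareInequality

variable {D : ℕ} {Ω : Set (EuclideanSpace ℝ (Fin D))} {φ : EuclideanSpace ℝ (Fin D) → ℝ} {p : ℝ}

lemma le_mul_of_rpow_le {a b C : ℝ} (ha : 0 ≤ a) (hb : 0 ≤ b) (hC : 0 ≤ C)
    (h : a ^ p ≤ C * (a ^ (p - 1) * b)) : a ≤ C * b := by
  obtain rfl | ha := ha.eq_or_lt
  · positivity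
  · refine le_of_mul_le_mul_left ?_ (Real.rpow_pos_of_pos ha (p - 1))
    calc a ^ (p - 1) * a = a ^ p := by rw [← Real.rpow_add_one ha.ne', sub_add_cancel]
      _ ≤ C * (a ^ (p - 1) * b) := h
      _ = a ^ (p - 1) * (C * b) := by ring

namespace IsTestFunction

lemma contDiff_one (hφ : IsTestFunction Ω φ) : ContDiff ℝ 1 φ :=
  hφ.contDiff.of_le (by exact_mod_cast le_top)

lemma setIntegral_norm_gradient (hφ : IsTestFunction Ω φ) :
    ∫ x in Ω, ‖∇ φ x‖ = ∫ x, ‖fderiv ℝ φ x‖ := by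
  rw [setIntegral_eq_integral_of_forall_compl_eq_zero fun x hx => by
    rw [hφ.gradient_eq_zero_of_notMem hx, norm_zero]]
  simp only [norm_gradient]

lemma setIntegral_norm_rpow (hφ : IsTestFunction Ω φ) (hp : 0 < p) :
    ∫ x in Ω, ‖φ x‖ ^ p = ∫ x, ‖φ x‖ ^ p :=
  setIntegral_eq_integral_of_forall_compl_eq_zero fun x hx => by
    rw [hφ.eq_zero_of_notMem hx, norm_zero, Real.zero_rpow hp.ne']

lemma integral_norm_fderiv_norm_rpow_le (hφ : IsTestFunction Ω φ) (hp : 1 < p) :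
    ∫ x, ‖fderiv ℝ (fun x => ‖φ x‖ ^ p) x‖ ≤ p * ∫ x in Ω, ‖φ x‖ ^ (p - 1) * ‖∇ φ x‖ := by
  have hle : ∀ x, ‖fderiv ℝ (fun x => ‖φ x‖ ^ p) x‖ ≤ p * (‖φ x‖ ^ (p - 1) * ‖∇ φ x‖) := fun x => by
    rw [norm_gradient, ← mul_assoc]
    exact norm_fderiv_norm_rpow_le hφ.differentiable hp
  rw [← integral_const_mul, ← setIntegral_eq_integral_of_forall_compl_eq_zero (s := Ω)]
  · exact integral_mono_of_nonneg (Eventually.of_forall fun _ => norm_nonneg _)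
      ((integrable_norm_rpow_mul_norm hp (hφ.memLp _) (hφ.memLp_gradient _)).const_mul p)
      (Eventually.of_forall hle)
  · refine fun x hx => le_antisymm ((hle x).trans_eq ?_) (norm_nonneg _)
    rw [hφ.gradient_eq_zero_of_notMem hx, norm_zero, mul_zero, mul_zero]

end IsTestFunction

namespace IsConvexDomain

variable [NeZero D]

lemma integral_abs_le (hΩ : IsConvexDomain Ω) {v : EuclideanSpace ℝ (Fin D) → ℝ}
    (hv : ContDiff ℝ 1 v) (hvc : HasCompactSupport v) (hvs : tsupport v ⊆ Ω) :
    ∫ x, |v x| ≤ (D + 1) * avgDist Ω * ∫ x, ‖fderiv ℝ v x‖ :=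
  integral_abs_le_inradius_mul hΩ.isOpen hΩ.isBounded hΩ.convex hΩ.frontier_nonempty
    (fun _ hx => hΩ.infDist_le_mul_avgDist hx) hv hvc hvs

lemma lpNorm_le (hΩ : IsConvexDomain Ω) (hp : 1 < p) (hφ : IsTestFunction Ω φ) :
    lpNorm φ (.ofReal p) (volume.restrict Ω) ≤
      (D + 1) * avgDist Ω * p * lpNorm (∇ φ) (.ofReal p) (volume.restrict Ω) := by
  have hp0 : 0 < p := by linarith
  have hR := hΩ.avgDist_pos
  have hsupp : Function.support (fun x => ‖φ x‖ ^ p) ⊆ Function.support φ := fun x hx hφx =>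
    hx (by simp only [hφx, norm_zero, Real.zero_rpow hp0.ne'])
  refine le_mul_of_rpow_le (p := p) lpNorm_nonneg lpNorm_nonneg (by positivity) ?_
  calc lpNorm φ (.ofReal p) (volume.restrict Ω) ^ p = ∫ x, |‖φ x‖ ^ p| := by
        rw [lpNorm_rpow hp0 (hφ.memLp (.ofReal p)).1, hφ.setIntegral_norm_rpow hp0]
        simp only [abs_of_nonneg (Real.rpow_nonneg (norm_nonneg _) p)]
    _ ≤ (D + 1) * avgDist Ω * ∫ x, ‖fderiv ℝ (fun x => ‖φ x‖ ^ p) x‖ :=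
        hΩ.integral_abs_le (hφ.contDiff_one.norm_rpow hp) (hφ.hasCompactSupport.mono hsupp)
          ((closure_mono hsupp).trans hφ.tsupport_subset)
    _ ≤ (D + 1) * avgDist Ω * (p * (lpNorm φ (.ofReal p) (volume.restrict Ω) ^ (p - 1) *
          lpNorm (∇ φ) (.ofReal p) (volume.restrict Ω))) := by
        gcongr
        exact (hφ.integral_norm_fderiv_norm_rpow_le hp).trans (by
          gcongr
          exact integral_norm_rpow_mul_norm_le hp (hφ.memLp _) (hφ.memLp_gradient _))
    _ = _ := by ring

lemma abs_setIntegral_le (hΩ : IsConvexDomain Ω) (hp : 1 ≤ p) (hφ : IsTestFunction Ω φ) :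
    |∫ x in Ω, φ x| ≤ (D + 1) * avgDist Ω * volume.real Ω ^ (1 - 1 / p) *
      lpNorm (∇ φ) (.ofReal p) (volume.restrict Ω) := by
  have := hΩ.isFiniteMeasure_volume_restrict
  have hR := hΩ.avgDist_pos
  calc |∫ x in Ω, φ x| ≤ ∫ x, |φ x| := by
        rw [hφ.setIntegral_eq]
        exact abs_integral_le_integral_abs
    _ ≤ (D + 1) * avgDist Ω * ∫ x in Ω, ‖∇ φ x‖ := by
        rw [hφ.setIntegral_norm_gradient]
        exact hΩ.integral_abs_le hφ.contDiff_one hφ.hasCompactSupport hφ.tsupport_subset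
    _ ≤ (D + 1) * avgDist Ω * (volume.real Ω ^ (1 - 1 / p) *
          lpNorm (∇ φ) (.ofReal p) (volume.restrict Ω)) := by
        gcongr
        simpa only [measureReal_restrict_apply_univ] using
          integral_norm_le_lpNorm hp (hφ.memLp_gradient (Ω := Ω) (.ofReal p))
    _ = _ := by ring

end IsConvexDomain

end PoincareInequality

section DirichletEnergy

variable {D : ℕ} {Ω : Set (EuclideanSpace ℝ (Fin D))} {p : ℝ}

/-- The infimum of the `p`-Dirichlet energy over the test functions on `Ω` of integral one. Its
minimizer is a multiple of the `p`-torsion function. -/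
noncomputable def leastDirichletEnergy (p : ℝ) (Ω : Set (EuclideanSpace ℝ (Fin D))) : ℝ :=
  sInf {e | ∃ ψ, IsTestFunction Ω ψ ∧ ∫ x in Ω, ψ x = 1 ∧ ∫ x in Ω, ‖∇ ψ x‖ ^ p = e}

lemma leastDirichletEnergy_le {ψ : EuclideanSpace ℝ (Fin D) → ℝ} (hψ : IsTestFunction Ω ψ)
    (h1 : ∫ x in Ω, ψ x = 1) : leastDirichletEnergy p Ω ≤ ∫ x in Ω, ‖∇ ψ x‖ ^ p :=
  csInf_le ⟨0, by rintro _ ⟨χ, -, -, rfl⟩; exact integral_norm_rpow_nonneg _⟩ ⟨ψ, hψ, h1, rfl⟩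

lemma leastDirichletEnergy_mul_le {ψ : EuclideanSpace ℝ (Fin D) → ℝ} (hψ : IsTestFunction Ω ψ)
    (hpos : 0 < ∫ x in Ω, ψ x) :
    leastDirichletEnergy p Ω * (∫ x in Ω, ψ x) ^ p ≤ ∫ x in Ω, ‖∇ ψ x‖ ^ p := by
  set c := ∫ x in Ω, ψ x with hc
  have h := leastDirichletEnergy_le (p := p) (hψ.const_smul c⁻¹) (by
    simp only [Pi.smul_apply, integral_smul]
    rw [← hc, smul_eq_mul, inv_mul_cancel₀ hpos.ne'])
  simp only [hψ.gradient_const_smul, Pi.smul_apply, norm_smul_rpow, integral_const_mul,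
    abs_of_pos (inv_pos.2 hpos), Real.inv_rpow hpos.le] at h
  rwa [le_inv_mul_iff₀ (Real.rpow_pos_of_pos hpos p), mul_comm] at h

lemma exists_isTestFunction_integral_eq_one (hΩ : IsOpen Ω) (hne : Ω.Nonempty) :
    ∃ φ, IsTestFunction Ω φ ∧ ∫ x in Ω, φ x = 1 := by
  obtain ⟨c, hc⟩ := hne
  obtain ⟨r, hr, hrΩ⟩ := Metric.isOpen_iff.1 hΩ c hc
  let f : ContDiffBump c := ⟨r / 4, r / 2, by positivity, by linarith⟩
  have hf : IsTestFunction Ω f := by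
    refine ⟨f.contDiff, f.hasCompactSupport, ?_⟩
    rw [f.tsupport_eq]
    exact (Metric.closedBall_subset_ball (half_lt_self hr)).trans hrΩ
  have hpos : 0 < ∫ x in Ω, f x := by
    rw [hf.setIntegral_eq]
    exact f.integral_pos
  refine ⟨_, hf.const_smul (∫ x in Ω, f x)⁻¹, ?_⟩
  simp only [Pi.smul_apply, integral_smul]
  rw [smul_eq_mul, inv_mul_cancel₀ hpos.ne']

lemma exists_minimizing_seq (hΩ : IsOpen Ω) (hne : Ω.Nonempty) :
    ∃ φ : ℕ → EuclideanSpace ℝ (Fin D) → ℝ, (∀ n, IsTestFunction Ω (φ n)) ∧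
      (∀ n, ∫ x in Ω, φ n x = 1) ∧
      Tendsto (fun n => ∫ x in Ω, ‖∇ (φ n) x‖ ^ p) atTop (𝓝 (leastDirichletEnergy p Ω)) := by
  obtain ⟨ψ, hψ, hψ1⟩ := exists_isTestFunction_integral_eq_one hΩ hne
  obtain ⟨e, -, he, hmem⟩ := exists_seq_tendsto_sInf
    (S := {e | ∃ ψ, IsTestFunction Ω ψ ∧ ∫ x in Ω, ψ x = 1 ∧ ∫ x in Ω, ‖∇ ψ x‖ ^ p = e})
    ⟨_, ψ, hψ, hψ1, rfl⟩
    ⟨0, by rintro _ ⟨χ, -, -, rfl⟩; exact integral_norm_rpow_nonneg _⟩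
  choose φ hφ hφ1 hφe using hmem
  exact ⟨φ, hφ, hφ1, he.congr fun n => (hφe n).symm⟩

lemma leastDirichletEnergy_pos (hΩ : IsOpen Ω) (hne : Ω.Nonempty) (hp : 0 < p) {A : ℝ} (hA : 0 < A)
    (h : ∀ ψ, IsTestFunction Ω ψ →
      |∫ x in Ω, ψ x| ≤ A * lpNorm (∇ ψ) (.ofReal p) (volume.restrict Ω)) :
    0 < leastDirichletEnergy p Ω := by
  obtain ⟨ψ, hψ, hψ1⟩ := exists_isTestFunction_integral_eq_one hΩ hne
  refine (by positivity : 0 < A⁻¹ ^ p).trans_le (le_csInf ⟨_, ψ, hψ, hψ1, rfl⟩ ?_)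
  rintro _ ⟨χ, hχ, hχ1, rfl⟩
  rw [← lpNorm_rpow hp (hχ.memLp_gradient (.ofReal p)).1]
  refine Real.rpow_le_rpow (by positivity) ((inv_le_iff_one_le_mul₀' hA).2 ?_) hp.le
  simpa only [hχ1, abs_one] using h χ hχ

variable {φ : ℕ → EuclideanSpace ℝ (Fin D) → ℝ}
  {G : EuclideanSpace ℝ (Fin D) → EuclideanSpace ℝ (Fin D)}

lemma tendsto_lpNorm_gradient_sub (hp : 1 < p) (hφ : ∀ n, IsTestFunction Ω (φ n))
    (hφ1 : ∀ n, ∫ x in Ω, φ n x = 1)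
    (hφK : Tendsto (fun n => ∫ x in Ω, ‖∇ (φ n) x‖ ^ p) atTop (𝓝 (leastDirichletEnergy p Ω))) :
    Tendsto (fun n : ℕ × ℕ => lpNorm (∇ (φ n.1) - ∇ (φ n.2)) (.ofReal p) (volume.restrict Ω))
      atTop (𝓝 0) := by
  have hInt := fun n => memLp_one_iff_integrable.1 ((hφ n).memLp (Ω := Ω) 1)
  have hmid : ∀ n m, leastDirichletEnergy p Ω ≤
      ∫ x in Ω, ‖(2⁻¹ : ℝ) • (∇ (φ n) x + ∇ (φ m) x)‖ ^ p := fun n m => by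
    have h1 : ∫ x in Ω, ((2⁻¹ : ℝ) • (φ n + φ m)) x = 1 := by
      simp only [Pi.smul_apply, Pi.add_apply, smul_eq_mul]
      rw [integral_const_mul, integral_add (hInt n) (hInt m), hφ1, hφ1]
      norm_num
    have h := leastDirichletEnergy_le (p := p) (((hφ n).add (hφ m)).const_smul (2⁻¹ : ℝ)) h1
    simpa only [((hφ n).add (hφ m)).gradient_const_smul, (hφ n).gradient_add (hφ m),
      Pi.smul_apply, Pi.add_apply] using h
  exact tendsto_lpNorm_sub_of_minimizing (f := fun n => ∇ (φ n)) hp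
    (fun n => (hφ n).memLp_gradient _) hφK hmid

lemma tendsto_integral_norm_gradient_add_smul (hp : 1 ≤ p) (hφ : ∀ n, IsTestFunction Ω (φ n))
    (hG : MemLp G (.ofReal p) (volume.restrict Ω))
    (hφG : Tendsto (fun n => lpNorm (∇ (φ n) - G) (.ofReal p) (volume.restrict Ω)) atTop (𝓝 0))
    {ψ : EuclideanSpace ℝ (Fin D) → ℝ} (hψ : IsTestFunction Ω ψ) (t : ℝ) :
    Tendsto (fun n => ∫ x in Ω, ‖∇ (φ n + t • ψ) x‖ ^ p) atTop
      (𝓝 (∫ x in Ω, ‖G x + t • ∇ ψ x‖ ^ p)) := by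
  have hp0 : 0 < p := by linarith
  have hadd : ∀ n, MemLp (∇ (φ n + t • ψ)) (.ofReal p) (volume.restrict Ω) := fun n =>
    ((hφ n).add (hψ.const_smul t)).memLp_gradient _
  have hGψ : MemLp (G + t • ∇ ψ) (.ofReal p) (volume.restrict Ω) :=
    hG.add ((hψ.memLp_gradient _).const_smul t)
  have hlim := tendsto_lpNorm (ENNReal.one_le_ofReal.2 hp) hadd hGψ (hφG.congr fun n => by
    rw [(hφ n).gradient_add (hψ.const_smul t), hψ.gradient_const_smul, add_sub_add_right_eq_sub])
  have hpow := hlim.rpow_const (p := p) (.inr hp0.le)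
  simp only [lpNorm_rpow hp0 (hadd _).1, lpNorm_rpow hp0 hGψ.1] at hpow
  exact hpow

lemma leastDirichletEnergy_mul_le_of_tendsto (hp : 1 ≤ p) (hφ : ∀ n, IsTestFunction Ω (φ n))
    (hφ1 : ∀ n, ∫ x in Ω, φ n x = 1) (hG : MemLp G (.ofReal p) (volume.restrict Ω))
    (hφG : Tendsto (fun n => lpNorm (∇ (φ n) - G) (.ofReal p) (volume.restrict Ω)) atTop (𝓝 0))
    {ψ : EuclideanSpace ℝ (Fin D) → ℝ} (hψ : IsTestFunction Ω ψ) {t : ℝ}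
    (ht : 0 < 1 + t * ∫ x in Ω, ψ x) :
    leastDirichletEnergy p Ω * (1 + t * ∫ x in Ω, ψ x) ^ p ≤
      ∫ x in Ω, ‖G x + t • ∇ ψ x‖ ^ p := by
  refine ge_of_tendsto' (tendsto_integral_norm_gradient_add_smul hp hφ hG hφG hψ t) fun n => ?_
  have hInt : ∫ x in Ω, (φ n + t • ψ) x = 1 + t * ∫ x in Ω, ψ x := by
    simp only [Pi.add_apply, Pi.smul_apply, smul_eq_mul]
    rw [integral_add (memLp_one_iff_integrable.1 ((hφ n).memLp 1))
      ((memLp_one_iff_integrable.1 (hψ.memLp 1)).const_mul t), integral_const_mul, hφ1]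
  rw [← hInt]
  exact leastDirichletEnergy_mul_le ((hφ n).add (hψ.const_smul t)) (hInt ▸ ht)

lemma integral_norm_rpow_mul_inner_eq_leastDirichletEnergy_mul (hp : 1 < p)
    (hφ : ∀ n, IsTestFunction Ω (φ n)) (hφ1 : ∀ n, ∫ x in Ω, φ n x = 1)
    (hφK : Tendsto (fun n => ∫ x in Ω, ‖∇ (φ n) x‖ ^ p) atTop (𝓝 (leastDirichletEnergy p Ω)))
    (hG : MemLp G (.ofReal p) (volume.restrict Ω))
    (hφG : Tendsto (fun n => lpNorm (∇ (φ n) - G) (.ofReal p) (volume.restrict Ω)) atTop (𝓝 0))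
    {ψ : EuclideanSpace ℝ (Fin D) → ℝ} (hψ : IsTestFunction Ω ψ) :
    ∫ x in Ω, ‖G x‖ ^ (p - 2) * inner ℝ (G x) (∇ ψ x) =
      leastDirichletEnergy p Ω * ∫ x in Ω, ψ x := by
  set K := leastDirichletEnergy p Ω
  set c := ∫ x in Ω, ψ x
  have hGK : ∫ x in Ω, ‖G x‖ ^ p = K := by
    have hlim := tendsto_integral_norm_gradient_add_smul hp.le hφ hG hφG hψ 0
    simp only [zero_smul, add_zero] at hlim
    exact tendsto_nhds_unique hlim hφK
  have hline : HasDerivAt (fun t : ℝ => 1 + t * c) c 0 := by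
    simpa only [id_eq, one_mul] using ((hasDerivAt_id (0 : ℝ)).mul_const c).const_add 1
  have hderiv : HasDerivAt (fun t : ℝ => K * (1 + t * c) ^ p) (K * (p * c)) 0 := by
    refine ((hline.rpow_const (p := p) (.inl (by simp))).const_mul K).congr_deriv ?_
    rw [zero_mul, add_zero, Real.one_rpow]
    ring
  have hmin : IsLocalMin
      (fun t : ℝ => (∫ x in Ω, ‖G x + t • ∇ ψ x‖ ^ p) - K * (1 + t * c) ^ p) 0 := by
    filter_upwards [hline.continuousAt.eventually (lt_mem_nhds (by simp : 0 < 1 + 0 * c))] with t ht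
    simp only [zero_smul, add_zero, zero_mul, Real.one_rpow, mul_one, hGK, sub_self, sub_nonneg]
    exact leastDirichletEnergy_mul_le_of_tendsto hp.le hφ hφ1 hG hφG hψ ht
  have hzero := hmin.hasDerivAt_eq_zero
    ((hasDerivAt_integral_norm_add_smul_rpow hp hG (hψ.memLp_gradient _)).sub hderiv)
  refine mul_left_cancel₀ (by linarith : p ≠ 0) ?_
  linarith

lemma exists_isTorsionFunction_of_poincare [IsFiniteMeasure (volume.restrict Ω)] (hΩ : IsOpen Ω)
    (hne : Ω.Nonempty) (hp : 1 < p) {A : ℝ}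
    (hA : ∀ ψ, IsTestFunction Ω ψ → lpNorm ψ (.ofReal p) (volume.restrict Ω) ≤
      A * lpNorm (∇ ψ) (.ofReal p) (volume.restrict Ω))
    (hK : 0 < leastDirichletEnergy p Ω) : ∃ u, IsTorsionFunction p Ω u := by
  obtain ⟨φ, hφ, hφ1, hφK⟩ := exists_minimizing_seq (p := p) hΩ hne
  have hq := ENNReal.one_le_ofReal.2 hp.le
  have hgrad := tendsto_lpNorm_gradient_sub hp hφ hφ1 hφK
  obtain ⟨G, hG, hφG⟩ := exists_tendsto_lpNorm_of_cauchy hq (fun n => (hφ n).memLp_gradient _) hgrad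
  obtain ⟨u, hu, hφu⟩ := exists_tendsto_lpNorm_of_cauchy hq (fun n => (hφ n).memLp _)
    (squeeze_zero (fun _ => lpNorm_nonneg)
      (fun n => (hφ n.1).gradient_sub (hφ n.2) ▸ hA _ ((hφ n.1).sub (hφ n.2)))
      (by simpa only [mul_zero] using hgrad.const_mul A))
  set c := leastDirichletEnergy p Ω ^ (-(1 / (p - 1)))
  have hc : 0 < c := Real.rpow_pos_of_pos hK _
  have hcK : c ^ (p - 1) * leastDirichletEnergy p Ω = 1 := by
    rw [← Real.rpow_mul hK.le, neg_mul, one_div_mul_cancel (by linarith), Real.rpow_neg_one,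
      inv_mul_cancel₀ hK.ne']
  refine ⟨c • u, c • G, .of_tendsto hp.le (hu.const_smul c) (hG.const_smul c)
    (fun n => (hφ n).const_smul c) ?_ ?_, fun ψ hψ => ?_⟩
  · simpa only [← smul_sub, lpNorm_const_smul, mul_zero] using hφu.const_mul (‖c‖₊ : ℝ)
  · simpa only [(hφ _).gradient_const_smul, ← smul_sub, lpNorm_const_smul, mul_zero] using
      hφG.const_mul (‖c‖₊ : ℝ)
  · simp only [Pi.smul_apply, norm_smul_rpow_mul_inner hc, integral_const_mul]
    rw [integral_norm_rpow_mul_inner_eq_leastDirichletEnergy_mul hp hφ hφ1 hφK hG hφG hψ,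
      ← mul_assoc, hcK, one_mul]

namespace IsConvexDomain

variable [NeZero D]

theorem exists_isTorsionFunction (hΩ : IsConvexDomain Ω) (hp : 1 < p) :
    ∃ u, IsTorsionFunction p Ω u := by
  have := hΩ.isFiniteMeasure_volume_restrict
  have hδ := hΩ.avgDist_pos
  have hV := hΩ.volume_real_pos
  exact exists_isTorsionFunction_of_poincare hΩ.isOpen hΩ.nonempty hp
    (fun ψ hψ => hΩ.lpNorm_le hp hψ)
    (leastDirichletEnergy_pos hΩ.isOpen hΩ.nonempty (by linarith) (by positivity)
      fun ψ hψ => hΩ.abs_setIntegral_le hp.le hψ)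

lemma isTorsionFunction_torsionFunction (hΩ : IsConvexDomain Ω) (hp : 1 < p) :
    IsTorsionFunction p Ω (torsionFunction p Ω) := by
  rw [torsionFunction, dif_pos (hΩ.exists_isTorsionFunction hp)]
  exact (hΩ.exists_isTorsionFunction hp).choose_spec

end IsConvexDomain

end DirichletEnergy

section Variational

variable {D : ℕ} {Ω : Set (EuclideanSpace ℝ (Fin D))} {p : ℝ}

namespace IsTorsionFunction

variable [IsFiniteMeasure (volume.restrict Ω)] {u : EuclideanSpace ℝ (Fin D) → ℝ}

lemma exists_approx (hu : IsTorsionFunction p Ω u) (hp : 1 < p) :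
    ∃ (G : EuclideanSpace ℝ (Fin D) → EuclideanSpace ℝ (Fin D))
      (φ : ℕ → EuclideanSpace ℝ (Fin D) → ℝ), MemLp G (.ofReal p) (volume.restrict Ω) ∧
      (∀ ψ, IsTestFunction Ω ψ →
        ∫ x in Ω, ‖G x‖ ^ (p - 2) * inner ℝ (G x) (∇ ψ x) = ∫ x in Ω, ψ x) ∧
      (∀ n, IsTestFunction Ω (φ n)) ∧
      Tendsto (fun n => lpNorm (∇ (φ n) - G) (.ofReal p) (volume.restrict Ω)) atTop (𝓝 0) ∧
      Tendsto (fun n => ∫ x in Ω, φ n x) atTop (𝓝 (∫ x in Ω, u x)) ∧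
      ∫ x in Ω, ‖G x‖ ^ p = ∫ x in Ω, u x := by
  obtain ⟨G, hG, heq⟩ := hu
  obtain ⟨φ, hφ, hφu, hφG⟩ := hG.exists_tendsto_lpNorm
  have hq := ENNReal.one_le_ofReal.2 hp.le
  have hφ1 := tendsto_integral_of_tendsto_integral_norm_sub
    (fun n => ((hφ n).memLp _).integrable hq) (hG.memSobolev.memLp.integrable hq)
    (tendsto_integral_norm_sub hp.le (fun n => (hφ n).memLp _) hG.memSobolev.memLp hφu)
  have henergy := tendsto_integral_norm_rpow_mul_inner hp hG.memSobolev.memLp_grad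
    hG.memSobolev.memLp_grad (fun n => (hφ n).memLp_gradient _) hφG
  simp only [heq _ (hφ _), norm_rpow_mul_inner_self (by linarith : p ≠ 0)] at henergy
  exact ⟨G, φ, hG.memSobolev.memLp_grad, heq, hφ, hφG, hφ1, tendsto_nhds_unique henergy hφ1⟩

lemma integral_nonneg (hu : IsTorsionFunction p Ω u) (hp : 1 < p) : 0 ≤ ∫ x in Ω, u x := by
  obtain ⟨G, -, -, -, -, -, -, hE⟩ := hu.exists_approx hp
  exact hE ▸ integral_norm_rpow_nonneg G

lemma abs_setIntegral_le (hu : IsTorsionFunction p Ω u) (hp : 1 < p)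
    {ψ : EuclideanSpace ℝ (Fin D) → ℝ} (hψ : IsTestFunction Ω ψ) :
    |∫ x in Ω, ψ x| ≤
      (∫ x in Ω, u x) ^ (1 - 1 / p) * lpNorm (∇ ψ) (.ofReal p) (volume.restrict Ω) := by
  obtain ⟨G, -, hG, heq, -, -, -, hE⟩ := hu.exists_approx hp
  have h := abs_integral_norm_rpow_mul_inner_le hp hG (hψ.memLp_gradient (Ω := Ω) _)
  rw [heq ψ hψ, lpNorm_eq_integral_norm_rpow (by linarith) hG.1, hE,
    ← Real.rpow_mul (hu.integral_nonneg hp)] at h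
  convert h using 3
  field_simp

lemma integral_rpow_le (hu : IsTorsionFunction p Ω u) (hp : 1 < p) {M : ℝ}
    (hM : ∀ ψ, IsTestFunction Ω ψ →
      |∫ x in Ω, ψ x| ≤ M * lpNorm (∇ ψ) (.ofReal p) (volume.restrict Ω))
    (hpos : 0 < ∫ x in Ω, u x) : (∫ x in Ω, u x) ^ (1 - 1 / p) ≤ M := by
  obtain ⟨G, φ, hG, -, hφ, hφG, hφ1, hE⟩ := hu.exists_approx hp
  have hle := le_of_tendsto_of_tendsto' hφ1 ((tendsto_lpNorm (ENNReal.one_le_ofReal.2 hp.le)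
    (fun n => (hφ n).memLp_gradient _) hG hφG).const_mul M)
    fun n => (le_abs_self _).trans (hM _ (hφ n))
  rw [lpNorm_eq_integral_norm_rpow (by linarith) hG.1, hE] at hle
  rwa [Real.rpow_sub hpos, Real.rpow_one, div_le_iff₀ (Real.rpow_pos_of_pos hpos _)]

end IsTorsionFunction

/-- The best constant in the inequality `|∫ ψ| ≤ C ‖∇ ψ‖_p` for test functions `ψ` on `Ω`; see
`IsConvexDomain.abs_setIntegral_le_torsionConst_mul` and `IsConvexDomain.torsionConst_le`. -/
noncomputable def torsionConst (p : ℝ) (Ω : Set (EuclideanSpace ℝ (Fin D))) : ℝ :=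
  torsionalRigidity p Ω ^ (1 - 1 / p)

/-- The scale-invariant quantity `δ(Ω) T(p; Ω) ^ (1 / p)`, where `δ(Ω)` is the average distance to
the boundary. -/
noncomputable def scaledRigidity (p : ℝ) (Ω : Set (EuclideanSpace ℝ (Fin D))) : ℝ :=
  avgDist Ω * (volume.real Ω ^ (1 - 1 / p) / torsionConst p Ω)

namespace IsConvexDomain

variable [NeZero D]

lemma torsionalRigidity_pos (hΩ : IsConvexDomain Ω) (hp : 1 < p) :
    0 < torsionalRigidity p Ω := by
  have := hΩ.isFiniteMeasure_volume_restrict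
  have hu := hΩ.isTorsionFunction_torsionFunction hp
  obtain ⟨φ, hφ, hφ1⟩ := exists_isTestFunction_integral_eq_one hΩ.isOpen hΩ.nonempty
  refine (hu.integral_nonneg hp).lt_of_ne fun h => ?_
  have hle := hu.abs_setIntegral_le hp hφ
  rw [← h, hφ1, Real.zero_rpow (sub_pos.2 ((div_lt_one (by linarith)).2 hp)).ne', zero_mul,
    abs_one] at hle
  exact hle.not_gt one_pos

lemma torsionConst_pos (hΩ : IsConvexDomain Ω) (hp : 1 < p) : 0 < torsionConst p Ω :=
  Real.rpow_pos_of_pos (hΩ.torsionalRigidity_pos hp) _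

lemma abs_setIntegral_le_torsionConst_mul (hΩ : IsConvexDomain Ω) (hp : 1 < p)
    {ψ : EuclideanSpace ℝ (Fin D) → ℝ} (hψ : IsTestFunction Ω ψ) :
    |∫ x in Ω, ψ x| ≤ torsionConst p Ω * lpNorm (∇ ψ) (.ofReal p) (volume.restrict Ω) :=
  have := hΩ.isFiniteMeasure_volume_restrict
  (hΩ.isTorsionFunction_torsionFunction hp).abs_setIntegral_le hp hψ

lemma torsionConst_le (hΩ : IsConvexDomain Ω) (hp : 1 < p) {M : ℝ}
    (hM : ∀ ψ, IsTestFunction Ω ψ →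
      |∫ x in Ω, ψ x| ≤ M * lpNorm (∇ ψ) (.ofReal p) (volume.restrict Ω)) :
    torsionConst p Ω ≤ M :=
  have := hΩ.isFiniteMeasure_volume_restrict
  (hΩ.isTorsionFunction_torsionFunction hp).integral_rpow_le hp hM (hΩ.torsionalRigidity_pos hp)

lemma scaledRigidity_pos (hΩ : IsConvexDomain Ω) (hp : 1 < p) : 0 < scaledRigidity p Ω :=
  mul_pos hΩ.avgDist_pos
    (div_pos (Real.rpow_pos_of_pos hΩ.volume_real_pos _) (hΩ.torsionConst_pos hp))

lemma normalizedRigidity_eq (hΩ : IsConvexDomain Ω) (hp : 1 < p) :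
    normalizedRigidity p Ω = (scaledRigidity p Ω / avgDist Ω) ^ p := by
  have hT := hΩ.torsionalRigidity_pos hp
  have hp0 : p ≠ 0 := by linarith
  rw [scaledRigidity, mul_div_cancel_left₀ _ hΩ.avgDist_pos.ne', normalizedRigidity,
    torsionConst, Real.div_rpow (by positivity) (by positivity),
    ← Real.rpow_mul hΩ.volume_real_pos.le, ← Real.rpow_mul hT.le, div_eq_mul_inv,
    ← Real.rpow_neg hT.le]
  congr 2
  · field_simp
  · field_simp
    ring

lemma one_div_le_scaledRigidity (hΩ : IsConvexDomain Ω) (hp : 1 < p) :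
    1 / ((D : ℝ) + 1) ≤ scaledRigidity p Ω := by
  have h := hΩ.torsionConst_le hp fun ψ hψ => hΩ.abs_setIntegral_le hp.le hψ
  rw [scaledRigidity, mul_div_assoc', div_le_div_iff₀ (by positivity) (hΩ.torsionConst_pos hp)]
  linarith

end IsConvexDomain

end Variational

section Scaling

variable {D : ℕ} {Ω : Set (EuclideanSpace ℝ (Fin D))} {p c : ℝ}

lemma volume_real_smul (hc : 0 < c) (Ω : Set (EuclideanSpace ℝ (Fin D))) :
    volume.real (c • Ω) = c ^ D * volume.real Ω := by
  rw [Measure.real, Measure.addHaar_smul_of_nonneg _ hc.le, finrank_euclideanSpace_fin,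
    ENNReal.toReal_mul, ENNReal.toReal_ofReal (by positivity), Measure.real]

lemma setIntegral_smul (hc : 0 < c) (Ω : Set (EuclideanSpace ℝ (Fin D)))
    (f : EuclideanSpace ℝ (Fin D) → ℝ) :
    ∫ x in c • Ω, f x = c ^ D * ∫ x in Ω, f (c • x) := by
  rw [Measure.setIntegral_comp_smul_of_pos _ _ _ hc, finrank_euclideanSpace_fin, smul_eq_mul,
    mul_inv_cancel_left₀ (by positivity)]

lemma frontier_smul (hc : c ≠ 0) (Ω : Set (EuclideanSpace ℝ (Fin D))) :
    frontier (c • Ω) = c • frontier Ω :=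
  ((Homeomorph.smulOfNeZero c hc).image_frontier Ω).symm

lemma avgDist_smul (hc : 0 < c) (Ω : Set (EuclideanSpace ℝ (Fin D))) :
    avgDist (c • Ω) = c * avgDist Ω := by
  rw [avgDist, avgDist, volume_real_smul hc, setIntegral_smul hc, frontier_smul hc.ne']
  simp only [infDist_smul₀ hc.ne', Real.norm_of_nonneg hc.le, integral_const_mul]
  field_simp

namespace IsTestFunction

variable {ψ : EuclideanSpace ℝ (Fin D) → ℝ}

lemma comp_smul (hψ : IsTestFunction (c • Ω) ψ) (hc : c ≠ 0) :
    IsTestFunction Ω fun x => ψ (c • x) where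
  contDiff := hψ.contDiff.comp (contDiff_const_smul c)
  hasCompactSupport := hψ.hasCompactSupport.comp_homeomorph (Homeomorph.smulOfNeZero c hc)
  tsupport_subset := (tsupport_comp_subset_preimage ψ (continuous_const_smul c)).trans fun _ hx =>
    (Set.smul_mem_smul_set_iff₀ hc _ _).1 (hψ.tsupport_subset hx)

lemma lpNorm_gradient_comp_smul (hψ : IsTestFunction (c • Ω) ψ) (hc : 0 < c) (hp : 0 < p) :
    lpNorm (∇ fun x => ψ (c • x)) (.ofReal p) (volume.restrict Ω) =
      c / (c ^ D) ^ (1 / p) * lpNorm (∇ ψ) (.ofReal p) (volume.restrict (c • Ω)) := by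
  have hgrad : (∇ fun x => ψ (c • x)) = fun x => c • ∇ ψ (c • x) := by
    ext1 x
    simp only [gradient, fderiv_comp_smul, map_smul]
  have hI : 0 ≤ ∫ x in Ω, ‖∇ ψ (c • x)‖ ^ p := integral_norm_rpow_nonneg fun x => ∇ ψ (c • x)
  rw [lpNorm_eq_integral_norm_rpow hp ((hψ.comp_smul hc.ne').memLp_gradient (.ofReal p)).1,
    lpNorm_eq_integral_norm_rpow hp (hψ.memLp_gradient (.ofReal p)).1, setIntegral_smul hc, hgrad]
  simp only [norm_smul_rpow, integral_const_mul, abs_of_pos hc]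
  rw [Real.mul_rpow (by positivity) hI, Real.mul_rpow (by positivity) hI, ← Real.rpow_mul hc.le,
    mul_one_div_cancel hp.ne', Real.rpow_one]
  field_simp

end IsTestFunction

namespace IsConvexDomain

lemma smul (hΩ : IsConvexDomain Ω) (hc : c ≠ 0) : IsConvexDomain (c • Ω) :=
  ⟨hΩ.nonempty.smul_set, hΩ.isOpen.smul₀ hc, hΩ.isBounded.smul₀ c, hΩ.convex.smul c⟩

variable [NeZero D]

lemma torsionConst_smul_le (hΩ : IsConvexDomain Ω) (hp : 1 < p) (hc : 0 < c) :
    torsionConst p (c • Ω) ≤ c * (c ^ D) ^ (1 - 1 / p) * torsionConst p Ω := by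
  have hcD : 0 < c ^ D := by positivity
  refine (hΩ.smul hc.ne').torsionConst_le hp fun ψ hψ => ?_
  have h := hΩ.abs_setIntegral_le_torsionConst_mul hp (hψ.comp_smul hc.ne')
  rw [hψ.lpNorm_gradient_comp_smul hc (by linarith)] at h
  rw [setIntegral_smul hc, abs_mul, abs_of_pos hcD, Real.rpow_sub hcD, Real.rpow_one]
  refine (mul_le_mul_of_nonneg_left h hcD.le).trans_eq ?_
  ring

lemma torsionConst_smul (hΩ : IsConvexDomain Ω) (hp : 1 < p) (hc : 0 < c) :
    torsionConst p (c • Ω) = c * (c ^ D) ^ (1 - 1 / p) * torsionConst p Ω := by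
  refine (hΩ.torsionConst_smul_le hp hc).antisymm ?_
  have h := (hΩ.smul hc.ne').torsionConst_smul_le hp (inv_pos.2 hc)
  rwa [inv_smul_smul₀ hc.ne', inv_pow, Real.inv_rpow (by positivity), ← mul_inv,
    le_inv_mul_iff₀ (by positivity)] at h

lemma scaledRigidity_smul (hΩ : IsConvexDomain Ω) (hp : 1 < p) (hc : 0 < c) :
    scaledRigidity p (c • Ω) = scaledRigidity p Ω := by
  rw [scaledRigidity, scaledRigidity, avgDist_smul hc, volume_real_smul hc,
    hΩ.torsionConst_smul hp hc, Real.mul_rpow (by positivity) hΩ.volume_real_pos.le]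
  field_simp

end IsConvexDomain

end Scaling

section Mollification

variable {E : Type*} [NormedAddCommGroup E] [NormedSpace ℝ E] [FiniteDimensional ℝ E]
  [MeasurableSpace E] [BorelSpace E] {μ : Measure E} [μ.IsAddHaarMeasure] {g : E → ℝ}
  [HasContDiffBump E]

lemma lipschitzWith_convolution_normed (φ : ContDiffBump (0 : E)) {K : NNReal}
    (hg : LipschitzWith K g) :
    LipschitzWith K (convolution (φ.normed μ) g (ContinuousLinearMap.lsmul ℝ ℝ) μ) := by
  have hInt : ∀ x, Integrable (fun t => φ.normed μ t * g (x - t)) μ := fun x =>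
    (φ.continuous_normed.mul (hg.continuous.comp (by fun_prop))).integrable_of_hasCompactSupport
      φ.hasCompactSupport_normed.mul_right
  refine LipschitzWith.of_dist_le_mul fun x y => ?_
  simp only [dist_eq_norm, convolution, ContinuousLinearMap.lsmul_apply, smul_eq_mul]
  rw [← integral_sub (hInt x) (hInt y), ← one_mul (K * ‖x - y‖), ← φ.integral_normed (μ := μ),
    ← integral_mul_const]
  refine norm_integral_le_of_norm_le (φ.integrable_normed.mul_const _)
    (Eventually.of_forall fun t => ?_)
  rw [← mul_sub, norm_mul, Real.norm_of_nonneg (φ.nonneg_normed t)]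
  refine mul_le_mul_of_nonneg_left ?_ (φ.nonneg_normed t)
  simpa only [dist_eq_norm, sub_sub_sub_cancel_right] using hg.dist_le_mul (x - t) (y - t)

lemma convolution_normed_eventuallyEq_const (φ : ContDiffBump (0 : E))
    {x : E} {η : ℝ} (hη : φ.rOut < η) (hg : ∀ y ∈ Metric.ball x η, g y = g x) :
    convolution (φ.normed μ) g (ContinuousLinearMap.lsmul ℝ ℝ) μ =ᶠ[𝓝 x] fun _ => g x := by
  filter_upwards [Metric.ball_mem_nhds x (sub_pos.2 hη)] with y hy
  have hyx : g y = g x := hg y (Metric.ball_subset_ball (sub_le_self _ φ.rOut_pos.le) hy)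
  rw [φ.normed_convolution_eq_right fun z hz => ?_, hyx]
  rw [hyx]
  refine hg z ?_
  rw [Metric.mem_ball] at hz hy ⊢
  linarith [dist_triangle z y x]

lemma tsupport_convolution_normed_subset (φ : ContDiffBump (0 : E)) :
    tsupport (convolution (φ.normed μ) g (ContinuousLinearMap.lsmul ℝ ℝ) μ) ⊆
      Metric.cthickening φ.rOut (tsupport g) := by
  refine closure_minimal (fun x hx => ?_) Metric.isClosed_cthickening
  obtain ⟨y, hy, z, hz, rfl⟩ := support_convolution_subset_swap _ hx
  rw [φ.support_normed_eq, mem_ball_zero_iff] at hz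
  refine Metric.mem_cthickening_of_dist_le _ y _ _ (subset_tsupport g hy) ?_
  simpa only [dist_self_add_left] using hz.le

end Mollification

section DistanceFunctions

variable {D : ℕ} {Ω : Set (EuclideanSpace ℝ (Fin D))} {p : ℝ}

lemma exists_isTestFunction_of_lipschitz (hΩ : IsOpen Ω) {g : EuclideanSpace ℝ (Fin D) → ℝ}
    {K : NNReal} (hg : LipschitzWith K g) (hgc : HasCompactSupport g) (hgs : tsupport g ⊆ Ω)
    {η : ℝ} (hη : 0 < η) :
    ∃ v, IsTestFunction Ω v ∧ (∀ x, ‖∇ v x‖ ≤ K) ∧ ∫ x, v x = ∫ x, g x ∧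
      ∀ x, (∀ y ∈ Metric.ball x η, g y = g x) → ∇ v x = 0 := by
  obtain ⟨r, hr, hrΩ⟩ := hgc.isCompact.exists_cthickening_subset_open hΩ hgs
  have hm : 0 < min r η := lt_min hr hη
  let φ : ContDiffBump (0 : EuclideanSpace ℝ (Fin D)) :=
    ⟨min r η / 4, min r η / 2, by positivity, by linarith⟩
  have hφr : φ.rOut < r := (half_lt_self hm).trans_le (min_le_left _ _)
  have hφη : φ.rOut < η := (half_lt_self hm).trans_le (min_le_right _ _)
  have hgi : Integrable g := hg.continuous.integrable_of_hasCompactSupport hgc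
  refine ⟨convolution (φ.normed volume) g (ContinuousLinearMap.lsmul ℝ ℝ) volume,
    ⟨φ.hasCompactSupport_normed.contDiff_convolution_left _ φ.contDiff_normed
        hgi.locallyIntegrable, φ.hasCompactSupport_normed.convolution _ hgc,
      (tsupport_convolution_normed_subset φ).trans
        ((Metric.cthickening_mono hφr.le _).trans hrΩ)⟩, fun x => ?_, ?_, fun x hx => ?_⟩
  · rw [norm_gradient]
    exact norm_fderiv_le_of_lipschitz ℝ (lipschitzWith_convolution_normed φ hg)
  · rw [integral_convolution _ φ.integrable_normed hgi, φ.integral_normed,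
      ContinuousLinearMap.lsmul_apply, one_smul]
  · rw [(convolution_normed_eventuallyEq_const φ hφη hx).gradient_eq, gradient_fun_const]

/-- The profile `min (max (t - ε) 0) (s - 2 ε)` approximates `min t s`. It vanishes for `t ≤ ε`,
is constant for `s - ε ≤ t`, and has slope at most one. -/
noncomputable def truncation (s ε t : ℝ) : ℝ := min (max (t - ε) 0) (s - 2 * ε)

lemma lipschitzWith_truncation (s ε : ℝ) : LipschitzWith 1 (truncation s ε) :=
  (((LipschitzWith.id.sub (LipschitzWith.const ε)).max_const 0).min_const (s - 2 * ε)).weaken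
    (by simp)

lemma truncation_of_le {s ε t : ℝ} (hs : 2 * ε ≤ s) (ht : t ≤ ε) : truncation s ε t = 0 := by
  rw [truncation, max_eq_right (by linarith), min_eq_left (by linarith)]

lemma truncation_of_ge {s ε t : ℝ} (ht : s - ε ≤ t) : truncation s ε t = s - 2 * ε :=
  min_eq_right (le_max_of_le_left (by linarith))

lemma min_sub_le_truncation {s ε : ℝ} (hε : 0 ≤ ε) (t : ℝ) : min t s - 2 * ε ≤ truncation s ε t :=
  le_min (le_max_of_le_left (by linarith [min_le_left t s])) (by linarith [min_le_right t s])

lemma infDist_compl_eq_infDist_frontier (hΩ : IsOpen Ω) (hfr : (frontier Ω).Nonempty)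
    {x : EuclideanSpace ℝ (Fin D)} (hx : x ∈ Ω) :
    Metric.infDist x Ωᶜ = Metric.infDist x (frontier Ω) := by
  have hsub : frontier Ω ⊆ Ωᶜ := Set.subset_compl_iff_disjoint_left.2
    (Set.disjoint_iff_inter_eq_empty.2 hΩ.inter_frontier_eq)
  refine (Metric.infDist_le_infDist_of_subset hsub hfr).antisymm ?_
  rw [Metric.le_infDist (hfr.mono hsub)]
  intro y hy
  by_contra! hlt
  rw [dist_comm] at hlt
  exact hy (ball_infDist_frontier_subset hΩ hx hlt)

lemma lpNorm_le_measureReal_rpow {α F : Type*} [MeasurableSpace α] {μ : Measure α}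
    [NormedAddCommGroup F] {s : Set α} {f : α → F} (hs : MeasurableSet s) (hμs : μ s ≠ ⊤)
    (hp : 0 < p) (hf : ∀ x, ‖f x‖ ≤ s.indicator 1 x) :
    lpNorm f (.ofReal p) μ ≤ μ.real s ^ (1 / p) := by
  have hind : MemLp (s.indicator fun _ => (1 : ℝ)) (.ofReal p) μ :=
    memLp_indicator_const _ hs _ (.inr hμs)
  refine (lpNorm_mono_real hind hf).trans_eq ?_
  rw [← toReal_eLpNorm hind.1, eLpNorm_indicator_const hs (ENNReal.ofReal_pos.2 hp).ne'
    ENNReal.ofReal_ne_top, ENNReal.toReal_mul, ← ENNReal.toReal_rpow, ENNReal.toReal_ofReal hp.le,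
    enorm_one, ENNReal.toReal_one, one_mul, Measure.real]

lemma superlevel_infDist_compl_subset {X : Type*} [PseudoMetricSpace X] (s : Set X) {ε : ℝ}
    (hε : 0 < ε) : {x | ε ≤ Metric.infDist x sᶜ} ⊆ s := fun x hx => by
  by_contra hxs
  rw [Set.mem_ofPred_eq, Metric.infDist_zero_of_mem (Set.mem_compl hxs)] at hx
  exact hx.not_gt hε

lemma tsupport_comp_infDist_subset {X : Type*} [PseudoMetricSpace X] (s : Set X) {h : ℝ → ℝ}
    {ε : ℝ} (hh : ∀ t ≤ ε, h t = 0) :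
    tsupport (fun x => h (Metric.infDist x s)) ⊆ {x | ε ≤ Metric.infDist x s} :=
  closure_minimal (fun x hx => by
    by_contra hlt
    exact hx (hh _ (not_le.1 hlt).le))
    (isClosed_le continuous_const (Metric.continuous_infDist_pt _))

lemma exists_isTestFunction_truncation (hΩ : IsOpen Ω) (hΩb : Bornology.IsBounded Ω)
    (hfr : (frontier Ω).Nonempty) {s ε : ℝ} (hε : 0 < ε) (hs : 2 * ε ≤ s) :
    ∃ v, IsTestFunction Ω v ∧ (∀ x, ‖∇ v x‖ ≤ 1) ∧
      ∫ x in Ω, v x = ∫ x in Ω, truncation s ε (Metric.infDist x (frontier Ω)) ∧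
      ∀ x ∈ Ω, s ≤ Metric.infDist x (frontier Ω) → ∇ v x = 0 := by
  have hdist := fun x hx => infDist_compl_eq_infDist_frontier (x := x) hΩ hfr hx
  have hlip : LipschitzWith 1 fun x => truncation s ε (Metric.infDist x Ωᶜ) :=
    ((lipschitzWith_truncation s ε).comp (Metric.lipschitz_infDist_pt Ωᶜ)).weaken (mul_one 1).le
  have hsupp := (tsupport_comp_infDist_subset Ωᶜ fun _ => truncation_of_le hs).trans
    (superlevel_infDist_compl_subset Ω hε)
  have hcomp : HasCompactSupport fun x => truncation s ε (Metric.infDist x Ωᶜ) :=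
    Metric.isCompact_of_isClosed_isBounded (isClosed_tsupport _) (hΩb.subset hsupp)
  obtain ⟨v, hv, hv1, hvI, hv0⟩ := exists_isTestFunction_of_lipschitz hΩ hlip hcomp hsupp hε
  refine ⟨v, hv, hv1, ?_, fun x hx hxs => hv0 x fun y hy => ?_⟩
  · rw [hv.setIntegral_eq, hvI, ← setIntegral_eq_integral_of_forall_compl_eq_zero (s := Ω)
      fun x hx => image_eq_zero_of_notMem_tsupport fun h => hx (hsupp h)]
    exact setIntegral_congr_fun hΩ.measurableSet fun x hx => congrArg _ (hdist x hx)
  · rw [← hdist x hx] at hxs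
    have hxy : Metric.infDist x Ωᶜ ≤ Metric.infDist y Ωᶜ + dist x y :=
      Metric.infDist_le_infDist_add_dist
    rw [Metric.mem_ball, dist_comm] at hy
    rw [truncation_of_ge (by linarith), truncation_of_ge (by linarith)]

namespace IsConvexDomain

lemma integrableOn_min_infDist (hΩ : IsConvexDomain Ω) (s : ℝ) :
    IntegrableOn (fun x => min (Metric.infDist x (frontier Ω)) s) Ω :=
  hΩ.integrableOn_of_continuous ((Metric.continuous_infDist_pt _).min continuous_const)

variable [NeZero D]

lemma setIntegral_min_infDist_sub_le (hΩ : IsConvexDomain Ω) (hp : 1 < p) {s ε : ℝ} (hε : 0 < ε)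
    (hs : 2 * ε ≤ s) :
    ∫ x in Ω, (min (Metric.infDist x (frontier Ω)) s - 2 * ε) ≤ torsionConst p Ω *
      volume.real (Ω ∩ {x | Metric.infDist x (frontier Ω) < s}) ^ (1 / p) := by
  have := hΩ.isFiniteMeasure_volume_restrict
  have hmeas : MeasurableSet (Ω ∩ {x | Metric.infDist x (frontier Ω) < s}) :=
    (hΩ.isOpen.inter (isOpen_lt (Metric.continuous_infDist_pt _) continuous_const)).measurableSet
  obtain ⟨v, hv, hv1, hvI, hv0⟩ :=
    exists_isTestFunction_truncation hΩ.isOpen hΩ.isBounded hΩ.frontier_nonempty hε hs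
  have hgrad : ∀ x, ‖∇ v x‖ ≤
      (Ω ∩ {x | Metric.infDist x (frontier Ω) < s}).indicator 1 x := fun x => by
    refine Set.le_indicator_apply (fun _ => hv1 x) fun hx => ?_
    by_cases hxΩ : x ∈ Ω
    · rw [hv0 x hxΩ (not_lt.1 fun hlt => hx ⟨hxΩ, hlt⟩), norm_zero]
    · rw [hv.gradient_eq_zero_of_notMem hxΩ, norm_zero]
  calc ∫ x in Ω, (min (Metric.infDist x (frontier Ω)) s - 2 * ε)
      ≤ ∫ x in Ω, truncation s ε (Metric.infDist x (frontier Ω)) :=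
        integral_mono ((hΩ.integrableOn_min_infDist s).sub (integrable_const _))
          (hΩ.integrableOn_of_continuous ((lipschitzWith_truncation s ε).continuous.comp
            (Metric.continuous_infDist_pt _))) fun x => min_sub_le_truncation hε.le _
    _ ≤ torsionConst p Ω * lpNorm (∇ v) (.ofReal p) (volume.restrict Ω) :=
        hvI ▸ (le_abs_self _).trans (hΩ.abs_setIntegral_le_torsionConst_mul hp hv)
    _ ≤ _ := by
        refine mul_le_mul_of_nonneg_left ?_ (hΩ.torsionConst_pos hp).le
        refine (lpNorm_le_measureReal_rpow hmeas (measure_ne_top _ _) (by linarith) hgrad).trans_eq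
          ?_
        rw [measureReal_restrict_apply hmeas, Set.inter_eq_left.2 Set.inter_subset_left]

lemma setIntegral_min_infDist_le (hΩ : IsConvexDomain Ω) (hp : 1 < p) {s : ℝ} (hs : 0 < s) :
    ∫ x in Ω, min (Metric.infDist x (frontier Ω)) s ≤ torsionConst p Ω *
      volume.real (Ω ∩ {x | Metric.infDist x (frontier Ω) < s}) ^ (1 / p) := by
  have := hΩ.isFiniteMeasure_volume_restrict
  have hlim : Tendsto (fun ε => ∫ x in Ω, (min (Metric.infDist x (frontier Ω)) s - 2 * ε))
      (𝓝[>] 0) (𝓝 (∫ x in Ω, min (Metric.infDist x (frontier Ω)) s)) := by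
    simp only [integral_sub (hΩ.integrableOn_min_infDist s) (integrable_const _),
      integral_const, smul_eq_mul]
    refine Tendsto.mono_left (Continuous.tendsto' (by fun_prop) _ _ ?_) nhdsWithin_le_nhds
    ring
  refine le_of_tendsto hlim ?_
  filter_upwards [Ioo_mem_nhdsGT (half_pos hs)] with ε hε
  exact hΩ.setIntegral_min_infDist_sub_le hp hε.1 (by linarith [hε.2])

lemma scaledRigidity_le_iff (hΩ : IsConvexDomain Ω) (hp : 1 < p) {C : ℝ} :
    scaledRigidity p Ω ≤ C ↔
      avgDist Ω * volume.real Ω ≤ C * (torsionConst p Ω * volume.real Ω ^ (1 / p)) := by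
  have hV := hΩ.volume_real_pos
  have hT := hΩ.torsionConst_pos hp
  rw [scaledRigidity, Real.rpow_sub hV, Real.rpow_one, div_div, mul_div_assoc',
    div_le_iff₀ (by positivity), mul_comm (torsionConst p Ω)]

lemma scaledRigidity_le_one (hΩ : IsConvexDomain Ω) (hp : 1 < p) : scaledRigidity p Ω ≤ 1 := by
  have hδ := hΩ.avgDist_pos
  have hT := hΩ.torsionConst_pos hp
  rw [hΩ.scaledRigidity_le_iff hp, one_mul, hΩ.avgDist_mul_volume]
  calc ∫ x in Ω, Metric.infDist x (frontier Ω)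
      = ∫ x in Ω, min (Metric.infDist x (frontier Ω)) ((D + 1) * avgDist Ω) :=
        setIntegral_congr_fun hΩ.isOpen.measurableSet fun x hx =>
          (min_eq_left (hΩ.infDist_le_mul_avgDist hx)).symm
    _ ≤ torsionConst p Ω * volume.real
          (Ω ∩ {x | Metric.infDist x (frontier Ω) < (D + 1) * avgDist Ω}) ^ (1 / p) :=
        hΩ.setIntegral_min_infDist_le hp (by positivity)
    _ ≤ torsionConst p Ω * volume.real Ω ^ (1 / p) := by
        gcongr
        · exact hΩ.volume_ne_top
        · exact Set.inter_subset_left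

lemma scaledRigidity_le_of_volume_superlevel (hΩ : IsConvexDomain Ω) (hp : 1 < p) {s κ : ℝ}
    (hs : 0 < s) (hκ0 : 0 ≤ κ) (hκ1 : κ < 1)
    (hκ : (1 - κ) * volume.real Ω ≤
      volume.real (Ω ∩ {x | s ≤ Metric.infDist x (frontier Ω)})) :
    scaledRigidity p Ω ≤ avgDist Ω * (κ ^ (1 / p) / (s * (1 - κ))) := by
  have hδ := hΩ.avgDist_pos
  have hT := hΩ.torsionConst_pos hp
  have hV := hΩ.volume_real_pos
  have hmeas : MeasurableSet {x | s ≤ Metric.infDist x (frontier Ω)} :=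
    (isClosed_le continuous_const (Metric.continuous_infDist_pt _)).measurableSet
  have hlow : s * volume.real (Ω ∩ {x | s ≤ Metric.infDist x (frontier Ω)}) ≤
      ∫ x in Ω, min (Metric.infDist x (frontier Ω)) s := by
    have := mul_meas_ge_le_integral_of_nonneg (Eventually.of_forall fun x =>
      le_min Metric.infDist_nonneg hs.le) (hΩ.integrableOn_min_infDist s) s
    simpa only [le_min_iff, le_refl, and_true, measureReal_restrict_apply hmeas, Set.inter_comm Ω]
      using this
  have hsub : volume.real (Ω ∩ {x | Metric.infDist x (frontier Ω) < s}) ≤ κ * volume.real Ω := by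
    have hadd := measureReal_inter_add_sdiff (μ := volume) (s := Ω) hmeas hΩ.volume_ne_top
    simp only [Set.sdiff_eq, Set.compl_ofPred, not_le] at hadd
    linarith
  rw [hΩ.scaledRigidity_le_iff hp, mul_assoc (avgDist Ω)]
  refine mul_le_mul_of_nonneg_left ?_ hδ.le
  rw [div_mul_eq_mul_div, le_div_iff₀' (mul_pos hs (sub_pos.2 hκ1))]
  calc s * (1 - κ) * volume.real Ω
      ≤ ∫ x in Ω, min (Metric.infDist x (frontier Ω)) s :=
        (mul_assoc s _ _).trans_le ((mul_le_mul_of_nonneg_left hκ hs.le).trans hlow)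
    _ ≤ torsionConst p Ω * volume.real (Ω ∩ {x | Metric.infDist x (frontier Ω) < s}) ^ (1 / p) :=
        hΩ.setIntegral_min_infDist_le hp hs
    _ ≤ torsionConst p Ω * (κ * volume.real Ω) ^ (1 / p) := by gcongr
    _ = κ ^ (1 / p) * (torsionConst p Ω * volume.real Ω ^ (1 / p)) := by
        rw [Real.mul_rpow hκ0 hV.le]
        ring

end IsConvexDomain

end DistanceFunctions

section RadialDivergence

variable {E : Type*} [NormedAddCommGroup E] [NormedSpace ℝ E] [MeasurableSpace E] [BorelSpace E]
  {μ : Measure E} {φ : E → ℝ}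

lemma integrable_clm_mul_fderiv [IsFiniteMeasureOnCompacts μ] (hφ : ContDiff ℝ 1 φ)
    (hc : HasCompactSupport φ) (ℓ : E →L[ℝ] ℝ) (v : E) :
    Integrable (fun x => ℓ x * fderiv ℝ φ x v) μ :=
  (ℓ.continuous.mul ((hφ.continuous_fderiv one_ne_zero).clm_apply
    continuous_const)).integrable_of_hasCompactSupport (hc.fderiv_apply ℝ v).mul_left

variable [FiniteDimensional ℝ E] [μ.IsAddHaarMeasure]

lemma integral_clm_mul_fderiv (hφ : ContDiff ℝ 1 φ) (hc : HasCompactSupport φ) (ℓ : E →L[ℝ] ℝ)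
    (v : E) : ∫ x, ℓ x * fderiv ℝ φ x v ∂μ = -(ℓ v * ∫ x, φ x ∂μ) := by
  rw [integral_mul_fderiv_eq_neg_fderiv_mul_of_integrable ?_
    (integrable_clm_mul_fderiv hφ hc ℓ v) ?_ (fun x _ => ℓ.differentiableAt)
    (fun x _ => hφ.differentiable one_ne_zero x)]
  · simp only [ContinuousLinearMap.fderiv, integral_const_mul]
  · simpa only [ContinuousLinearMap.fderiv] using
      (hφ.continuous.integrable_of_hasCompactSupport hc).const_mul (ℓ v)
  · exact (ℓ.continuous.mul hφ.continuous).integrable_of_hasCompactSupport hc.mul_left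

lemma integral_fderiv_apply_self (hφ : ContDiff ℝ 1 φ) (hc : HasCompactSupport φ) :
    ∫ x, fderiv ℝ φ x x ∂μ = -(Module.finrank ℝ E * ∫ x, φ x ∂μ) := by
  set b := Module.finBasis ℝ E
  set ℓ : Fin (Module.finrank ℝ E) → E →L[ℝ] ℝ := fun i => (b.coord i).toContinuousLinearMap
  have hexpand : ∀ x, fderiv ℝ φ x x = ∑ i, ℓ i x * fderiv ℝ φ x (b i) := fun x => by
    conv_lhs => rw [← b.sum_repr x, map_sum, b.sum_repr x]
    simp [ℓ]
  simp only [hexpand]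
  rw [integral_finsetSum _ fun i _ => integrable_clm_mul_fderiv hφ hc (ℓ i) (b i)]
  simp only [integral_clm_mul_fderiv hφ hc]
  simp [ℓ]

end RadialDivergence

section Ball

variable {D : ℕ} {p : ℝ}

lemma isConvexDomain_ball (c : EuclideanSpace ℝ (Fin D)) {r : ℝ} (hr : 0 < r) :
    IsConvexDomain (Metric.ball c r) :=
  ⟨⟨c, Metric.mem_ball_self hr⟩, Metric.isOpen_ball, Metric.isBounded_ball, convex_ball _ _⟩

lemma IsTestFunction.mul_abs_setIntegral_ball_le {r : ℝ} {φ : EuclideanSpace ℝ (Fin D) → ℝ}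
    (hφ : IsTestFunction (Metric.ball 0 r) φ) :
    D * |∫ x in Metric.ball 0 r, φ x| ≤ r * ∫ x in Metric.ball 0 r, ‖∇ φ x‖ := by
  have hdiv := integral_fderiv_apply_self (μ := volume) hφ.contDiff_one hφ.hasCompactSupport
  rw [finrank_euclideanSpace_fin] at hdiv
  have hball : ∫ x in Metric.ball 0 r, fderiv ℝ φ x x = ∫ x, fderiv ℝ φ x x :=
    setIntegral_eq_integral_of_forall_compl_eq_zero fun x hx => by
      rw [← inner_gradient_left, hφ.gradient_eq_zero_of_notMem hx, inner_zero_left]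
  calc D * |∫ x in Metric.ball 0 r, φ x| = ‖∫ x in Metric.ball 0 r, fderiv ℝ φ x x‖ := by
        rw [hball, hdiv, hφ.setIntegral_eq, norm_neg, Real.norm_eq_abs, abs_mul, Nat.abs_cast]
    _ ≤ ∫ x in Metric.ball 0 r, r * ‖∇ φ x‖ := by
        refine norm_integral_le_of_norm_le
          ((memLp_one_iff_integrable.1 (hφ.memLp_gradient 1)).norm.const_mul r)
          ((ae_restrict_iff' measurableSet_ball).2 (Eventually.of_forall fun x hx => ?_))
        rw [norm_gradient, mul_comm]
        exact (fderiv ℝ φ x).le_opNorm_of_le (mem_ball_zero_iff.1 hx).le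
    _ = r * ∫ x in Metric.ball 0 r, ‖∇ φ x‖ := integral_const_mul _ _

variable [NeZero D]

lemma torsionConst_ball_le (hp : 1 < p) {r : ℝ} (hr : 0 < r) :
    torsionConst p (Metric.ball (0 : EuclideanSpace ℝ (Fin D)) r) ≤
      r / D * volume.real (Metric.ball (0 : EuclideanSpace ℝ (Fin D)) r) ^ (1 - 1 / p) := by
  have hΩ := isConvexDomain_ball (0 : EuclideanSpace ℝ (Fin D)) hr
  have := hΩ.isFiniteMeasure_volume_restrict
  have hD : (0 : ℝ) < D := by exact_mod_cast NeZero.pos D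
  refine hΩ.torsionConst_le hp fun ψ hψ => ?_
  have hHolder := integral_norm_le_lpNorm hp.le
    (hψ.memLp_gradient (Ω := Metric.ball 0 r) (ENNReal.ofReal p))
  rw [measureReal_restrict_apply_univ] at hHolder
  rw [div_mul_eq_mul_div, div_mul_eq_mul_div, le_div_iff₀' hD, mul_assoc]
  exact hψ.mul_abs_setIntegral_ball_le.trans (mul_le_mul_of_nonneg_left hHolder hr.le)

lemma le_scaledRigidity_ball (hp : 1 < p) {r : ℝ} (hr : 0 < r) :
    (D : ℝ) / (D + 1) ≤ scaledRigidity p (Metric.ball (0 : EuclideanSpace ℝ (Fin D)) r) := by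
  set B := Metric.ball (0 : EuclideanSpace ℝ (Fin D)) r
  have hΩ : IsConvexDomain B := isConvexDomain_ball 0 hr
  have hD : (0 : ℝ) < D := by exact_mod_cast NeZero.pos D
  have hinradius : r ≤ (D + 1) * avgDist B :=
    (le_infDist_frontier hΩ.isOpen hΩ.frontier_nonempty subset_rfl).trans
      (hΩ.infDist_le_mul_avgDist (Metric.mem_ball_self hr))
  have hV := hΩ.volume_real_pos
  have hT := hΩ.torsionConst_pos hp
  rw [scaledRigidity, mul_div_assoc', div_le_div_iff₀ (by positivity) hT]
  calc D * torsionConst p B ≤ D * (r / D * volume.real B ^ (1 - 1 / p)) := by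
        gcongr; exact torsionConst_ball_le hp hr
    _ = r * volume.real B ^ (1 - 1 / p) := by field_simp
    _ ≤ (D + 1) * avgDist B * volume.real B ^ (1 - 1 / p) := by gcongr
    _ = _ := by ring

end Ball

section Box

lemma one_sub_sum_le_prod_one_sub {ι R : Type*} [CommRing R] [PartialOrder R] [IsOrderedRing R]
    (s : Finset ι) {a : ι → R} (h0 : ∀ i ∈ s, 0 ≤ a i) (h1 : ∀ i ∈ s, a i ≤ 1) :
    1 - ∑ i ∈ s, a i ≤ ∏ i ∈ s, (1 - a i) := by
  induction s using Finset.cons_induction with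
  | empty => simp
  | cons i s hi ih =>
    simp only [Finset.forall_mem_cons] at h0 h1
    rw [Finset.sum_cons, Finset.prod_cons]
    calc 1 - (a i + ∑ j ∈ s, a j)
        ≤ 1 - (a i + ∑ j ∈ s, a j) + a i * ∑ j ∈ s, a j :=
          le_add_of_nonneg_right (mul_nonneg h0.1 (Finset.sum_nonneg h0.2))
      _ = (1 - a i) * (1 - ∑ j ∈ s, a j) := by ring
      _ ≤ (1 - a i) * ∏ j ∈ s, (1 - a j) :=
          mul_le_mul_of_nonneg_left (ih h0.2 h1.2) (sub_nonneg.2 h1.1)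

lemma setIntegral_Ioo_sub_abs {l : ℝ} (hl : 0 ≤ l) :
    ∫ t in Set.Ioo (-l) l, (l - |t|) = l ^ 2 := by
  have hpos : ∫ t in (0 : ℝ)..l, (l - |t|) = l ^ 2 / 2 := by
    have hcongr : ∫ t in (0 : ℝ)..l, (l - |t|) = ∫ t in (0 : ℝ)..l, (l - t) :=
      intervalIntegral.integral_congr fun t ht => by
        rw [Set.uIcc_of_le hl] at ht
        rw [abs_of_nonneg ht.1]
    rw [hcongr, intervalIntegral.integral_sub (by simp) (by simp)]
    simp only [intervalIntegral.integral_const, integral_id, smul_eq_mul]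
    ring
  have hneg : ∫ t in -l..0, (l - |t|) = ∫ t in (0 : ℝ)..l, (l - |t|) := by
    simpa using (intervalIntegral.integral_comp_neg (a := 0) (b := l) fun t => l - |t|).symm
  rw [← integral_Ioc_eq_integral_Ioo, ← intervalIntegral.integral_of_le (by linarith),
    ← intervalIntegral.integral_add_adjacent_intervals (b := 0)
      (Continuous.intervalIntegrable (by fun_prop) _ _)
      (Continuous.intervalIntegrable (by fun_prop) _ _), hneg, hpos, add_halves]

/-- The open box with half-side lengths `ℓ i` centred at the origin. -/
def box {D : ℕ} (ℓ : Fin D → ℝ) : Set (EuclideanSpace ℝ (Fin D)) :=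
  WithLp.ofLp ⁻¹' Set.univ.pi fun i => Set.Ioo (-ℓ i) (ℓ i)

variable {D : ℕ} {ℓ : Fin D → ℝ} {x : EuclideanSpace ℝ (Fin D)}

lemma mem_box : x ∈ box ℓ ↔ ∀ i, |x i| < ℓ i := by
  simp [box, abs_lt]

lemma isConvexDomain_box (hℓ : ∀ i, 0 < ℓ i) : IsConvexDomain (box ℓ) where
  nonempty := ⟨0, mem_box.2 fun i => by simpa using hℓ i⟩
  isOpen := (isOpen_set_pi Set.finite_univ fun _ _ => isOpen_Ioo).preimage
    (PiLp.continuous_ofLp 2 _)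
  isBounded := (PiLp.antilipschitzWith_ofLp 2 _).isBounded_preimage
    (Bornology.IsBounded.pi fun _ => Metric.isBounded_Ioo _ _)
  convex := (convex_pi fun _ _ => convex_Ioo _ _).linear_preimage
    (WithLp.linearEquiv 2 ℝ (Fin D → ℝ)).toLinearMap

lemma setIntegral_box_prod (ℓ : Fin D → ℝ) (f : Fin D → ℝ → ℝ) :
    ∫ x in box ℓ, ∏ i, f i (x i) = ∏ i, ∫ t in Set.Ioo (-ℓ i) (ℓ i), f i t := by
  rw [box, (PiLp.volume_preserving_ofLp (Fin D)).setIntegral_preimage_emb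
    (MeasurableEquiv.toLp 2 (Fin D → ℝ)).symm.measurableEmbedding
    (fun y : Fin D → ℝ => ∏ i, f i (y i)), volume_pi, Measure.restrict_pi_pi,
    integral_fintype_prod_eq_prod]

lemma volume_real_box (hℓ : ∀ i, 0 ≤ ℓ i) : volume.real (box ℓ) = ∏ i, 2 * ℓ i := by
  have h := setIntegral_box_prod ℓ fun _ _ => 1
  simp only [Finset.prod_const_one, integral_const, smul_eq_mul, mul_one,
    measureReal_restrict_apply_univ] at h
  rw [h]
  refine Finset.prod_congr rfl fun i _ => ?_
  rw [Real.volume_real_Ioo_of_le (by linarith [hℓ i])]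
  ring

lemma setIntegral_box_comp_apply (hℓ : ∀ i, 0 < ℓ i) (i : Fin D) (g : ℝ → ℝ) :
    ∫ x in box ℓ, g (x i) =
      (∫ t in Set.Ioo (-ℓ i) (ℓ i), g t) / (2 * ℓ i) * volume.real (box ℓ) := by
  have hprod (x : EuclideanSpace ℝ (Fin D)) :
      g (x i) = ∏ j, (if j = i then g else fun _ => 1) (x j) := by
    rw [Finset.prod_eq_single i (fun j _ hj => by simp only [if_neg hj]) (by simp), if_pos rfl]
  have hside : ∀ j ∈ Finset.univ.erase i,
      ∫ t in Set.Ioo (-ℓ j) (ℓ j), (if j = i then g else fun _ => 1) t = 2 * ℓ j := by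
    intro j hj
    simp only [if_neg (Finset.ne_of_mem_erase hj), integral_const, smul_eq_mul, mul_one,
      measureReal_restrict_apply_univ]
    rw [Real.volume_real_Ioo_of_le (by linarith [hℓ j])]
    ring
  have hi := (hℓ i).ne'
  simp only [hprod]
  rw [setIntegral_box_prod, volume_real_box fun j => (hℓ j).le,
    ← Finset.mul_prod_erase _ _ (Finset.mem_univ i), Finset.prod_congr rfl hside, if_pos rfl,
    ← Finset.mul_prod_erase _ (fun j => 2 * ℓ j) (Finset.mem_univ i)]
  field_simp

variable [NeZero D]

lemma infDist_frontier_box_le (hℓ : ∀ i, 0 < ℓ i) (i : Fin D) (hx : x ∈ box ℓ) :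
    Metric.infDist x (frontier (box ℓ)) ≤ ℓ i - |x i| := by
  have hΩ := isConvexDomain_box hℓ
  have hle {t : ℝ} (ht : ℓ i ≤ |t|) : Metric.infDist x (frontier (box ℓ)) ≤ |t - x i| := by
    have hy : x + EuclideanSpace.single i (t - x i) ∈ (box ℓ)ᶜ := fun h => by
      have := mem_box.1 h i
      simp only [PiLp.add_apply, PiLp.single_apply, if_true, add_sub_cancel] at this
      exact this.not_ge ht
    rw [← infDist_compl_eq_infDist_frontier hΩ.isOpen hΩ.frontier_nonempty hx]
    refine (Metric.infDist_le_dist_of_mem hy).trans_eq ?_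
    rw [dist_self_add_right, PiLp.norm_single, Real.norm_eq_abs]
  have hxi := abs_lt.1 (mem_box.1 hx i)
  rcases abs_cases (x i) with h | h
  · exact (hle (le_abs_self _)).trans_eq (by rw [h.1, abs_of_pos (by linarith)])
  · refine (hle (t := -ℓ i) ((le_abs_self _).trans_eq (abs_neg _).symm)).trans_eq ?_
    rw [h.1, abs_of_neg (by linarith)]
    ring

lemma le_infDist_frontier_box (hℓ : ∀ i, 0 < ℓ i) {s : ℝ} (hx : x ∈ box fun i => ℓ i - s) :
    s ≤ Metric.infDist x (frontier (box ℓ)) := by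
  have hΩ := isConvexDomain_box hℓ
  refine le_infDist_frontier hΩ.isOpen hΩ.frontier_nonempty fun y hy => mem_box.2 fun i => ?_
  calc |y i| ≤ |x i| + |y i - x i| := by simpa using abs_add_le (x i) (y i - x i)
    _ ≤ |x i| + dist y x := by
        gcongr
        exact (PiLp.norm_apply_le (y - x) i).trans_eq (dist_eq_norm y x).symm
    _ < (ℓ i - s) + s := add_lt_add (mem_box.1 hx i) hy
    _ = ℓ i := sub_add_cancel _ _

lemma avgDist_box_le (hℓ : ∀ i, 0 < ℓ i) (i : Fin D) : avgDist (box ℓ) ≤ ℓ i / 2 := by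
  have hΩ := isConvexDomain_box hℓ
  refine le_of_mul_le_mul_right ?_ hΩ.volume_real_pos
  have hi := (hℓ i).ne'
  calc avgDist (box ℓ) * volume.real (box ℓ)
      = ∫ x in box ℓ, Metric.infDist x (frontier (box ℓ)) := hΩ.avgDist_mul_volume
    _ ≤ ∫ x in box ℓ, (ℓ i - |x i|) :=
        setIntegral_mono_on (hΩ.integrableOn_of_continuous (Metric.continuous_infDist_pt _))
          (hΩ.integrableOn_of_continuous (by fun_prop)) hΩ.isOpen.measurableSet
          fun x hx => infDist_frontier_box_le hℓ i hx
    _ = ℓ i / 2 * volume.real (box ℓ) := by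
        rw [setIntegral_box_comp_apply hℓ i fun t => ℓ i - |t|, setIntegral_Ioo_sub_abs (hℓ i).le]
        field_simp

lemma one_sub_sum_mul_volume_box_le (hℓ : ∀ i, 0 < ℓ i) {s : ℝ} (hs0 : 0 ≤ s)
    (hs : ∀ i, s ≤ ℓ i) :
    (1 - ∑ i, s / ℓ i) * volume.real (box ℓ) ≤
      volume.real (box ℓ ∩ {x | s ≤ Metric.infDist x (frontier (box ℓ))}) := by
  have hΩ := isConvexDomain_box hℓ
  calc (1 - ∑ i, s / ℓ i) * volume.real (box ℓ)
      ≤ (∏ i, (1 - s / ℓ i)) * volume.real (box ℓ) := by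
        gcongr
        exact one_sub_sum_le_prod_one_sub _ (fun i _ => div_nonneg hs0 (hℓ i).le)
          fun i _ => (div_le_one (hℓ i)).2 (hs i)
    _ = volume.real (box fun i => ℓ i - s) := by
        rw [volume_real_box fun i => sub_nonneg.2 (hs i), volume_real_box fun i => (hℓ i).le,
          ← Finset.prod_mul_distrib]
        refine Finset.prod_congr rfl fun i _ => ?_
        have := (hℓ i).ne'
        field_simp
    _ ≤ _ := by
        refine measureReal_mono (fun x hx => ⟨mem_box.2 fun i => ?_,
          le_infDist_frontier_box hℓ hx⟩) (measure_ne_top_of_subset Set.inter_subset_left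
            hΩ.volume_ne_top)
        linarith [mem_box.1 hx i]

lemma IsConvexDomain.eventually_scaledRigidity_lt {Ω : Set (EuclideanSpace ℝ (Fin D))}
    (hΩ : IsConvexDomain Ω) {s κ C : ℝ} (hs : 0 < s) (hκ0 : 0 < κ) (hκ1 : κ < 1)
    (hκ : (1 - κ) * volume.real Ω ≤ volume.real (Ω ∩ {x | s ≤ Metric.infDist x (frontier Ω)}))
    (hC : avgDist Ω * (κ / (s * (1 - κ))) < C) : ∀ᶠ p in 𝓝[>] 1, scaledRigidity p Ω < C := by
  have hlim : Tendsto (fun p : ℝ => avgDist Ω * (κ ^ (1 / p) / (s * (1 - κ)))) (𝓝[>] 1)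
      (𝓝 (avgDist Ω * (κ / (s * (1 - κ))))) := by
    have hpow : ContinuousAt (fun p : ℝ => κ ^ (1 / p)) 1 :=
      (Real.continuousAt_const_rpow hκ0.ne').comp (by fun_prop (disch := norm_num))
    have := hpow.tendsto
    rw [div_one, Real.rpow_one] at this
    exact ((this.mono_left nhdsWithin_le_nhds).div_const _).const_mul _
  filter_upwards [hlim.eventually_lt_const hC, self_mem_nhdsWithin] with p hpC hp
  exact (hΩ.scaledRigidity_le_of_volume_superlevel hp hs hκ0.le hκ1 hκ).trans_lt hpC

variable (D) in
lemma exists_eventually_scaledRigidity_lt :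
    ∃ Ω : Set (EuclideanSpace ℝ (Fin D)), IsConvexDomain Ω ∧
      ∀ᶠ p in 𝓝[>] 1, scaledRigidity p Ω < 2 / 3 := by
  have hD : (1 : ℝ) ≤ D := by exact_mod_cast NeZero.one_le
  set ℓ : Fin D → ℝ := fun i => if i = 0 then 1 else 8 * D with hℓ_def
  have hℓ1 : ∀ i, 1 ≤ ℓ i := fun i => by
    simp only [hℓ_def]
    split_ifs <;> linarith
  have hℓ : ∀ i, 0 < ℓ i := fun i => one_pos.trans_le (hℓ1 i)
  have hΩ := isConvexDomain_box hℓ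
  have hsum : ∑ i, (1 / 9 : ℝ) / ℓ i ≤ 1 / 8 := by
    have hterm : ∀ i, (1 / 9 : ℝ) / ℓ i ≤ (if i = 0 then 1 / 9 else 0) + 1 / (72 * D) := fun i => by
      simp only [hℓ_def]
      split_ifs
      · rw [div_one]
        exact le_add_of_nonneg_right (by positivity)
      · rw [zero_add, div_div]
        exact le_of_eq (by ring)
    refine (Finset.sum_le_sum fun i _ => hterm i).trans_eq ?_
    rw [Finset.sum_add_distrib, Finset.sum_ite_eq' Finset.univ 0, if_pos (Finset.mem_univ _),
      Finset.sum_const, Finset.card_univ, Fintype.card_fin, nsmul_eq_mul]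
    field_simp
    norm_num
  have havg : avgDist (box ℓ) ≤ 1 / 2 := (avgDist_box_le hℓ 0).trans_eq (by simp [hℓ_def])
  have hvol := one_sub_sum_mul_volume_box_le hℓ (s := 1 / 9) (by norm_num)
    fun i => (by norm_num : (1 / 9 : ℝ) ≤ 1).trans (hℓ1 i)
  -- The limit bound is `1 / 2 * (κ / (s * (1 - κ))) = 9 / 14`.
  refine ⟨box ℓ, hΩ, hΩ.eventually_scaledRigidity_lt (s := 1 / 9) (κ := 1 / 8) (by norm_num)
    (by norm_num) (by norm_num) (le_trans ?_ hvol) ?_⟩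
  · gcongr
  · linarith

end Box

section CriticalRatio

/-- The quotients of the scaled rigidities of two convex domains of `ℝ^D`, over all exponents
`p > 1`. -/
def rigidityQuotients (D : ℕ) : Set ℝ :=
  {t | ∃ (p : ℝ) (Ω Ω' : Set (EuclideanSpace ℝ (Fin D))), 1 < p ∧ IsConvexDomain Ω ∧
    IsConvexDomain Ω' ∧ scaledRigidity p Ω / scaledRigidity p Ω' = t}

/-- The constant `γ_D` of the theorem: if `a / b ≤ γ_D`, every domain with average distance `a` to
the boundary has at least the normalized rigidity of every domain with average distance `b`. -/
noncomputable def criticalRatio (D : ℕ) : ℝ := sInf (rigidityQuotients D)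

lemma rigidityQuotients_nonempty (D : ℕ) : (rigidityQuotients D).Nonempty :=
  have hB := isConvexDomain_ball (0 : EuclideanSpace ℝ (Fin D)) one_pos
  ⟨_, 2, _, _, one_lt_two, hB, hB, rfl⟩

variable {D : ℕ} [NeZero D] {p a b : ℝ} {Ω Ωa Ωb : Set (EuclideanSpace ℝ (Fin D))}

lemma one_div_le_of_mem_rigidityQuotients {t : ℝ} (ht : t ∈ rigidityQuotients D) :
    1 / ((D : ℝ) + 1) ≤ t := by
  obtain ⟨p, Ω, Ω', hp, hΩ, hΩ', rfl⟩ := ht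
  rw [le_div_iff₀ (hΩ'.scaledRigidity_pos hp)]
  exact (mul_le_of_le_one_right (by positivity) (hΩ'.scaledRigidity_le_one hp)).trans
    (hΩ.one_div_le_scaledRigidity hp)

lemma bddBelow_rigidityQuotients : BddBelow (rigidityQuotients D) :=
  ⟨_, fun _ => one_div_le_of_mem_rigidityQuotients⟩

variable (D) in
lemma one_div_le_criticalRatio : 1 / ((D : ℝ) + 1) ≤ criticalRatio D :=
  le_csInf (rigidityQuotients_nonempty D) fun _ => one_div_le_of_mem_rigidityQuotients

lemma criticalRatio_lt_one {n : ℕ} (hn : 2 ≤ n) : criticalRatio n < 1 := by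
  have : NeZero n := ⟨by omega⟩
  have hn' : (2 : ℝ) ≤ n := by exact_mod_cast hn
  obtain ⟨Ω, hΩ, hΩp⟩ := exists_eventually_scaledRigidity_lt n
  obtain ⟨p, hlt, hp : 1 < p⟩ := (hΩp.and self_mem_nhdsWithin).exists
  have hB := isConvexDomain_ball (0 : EuclideanSpace ℝ (Fin n)) one_pos
  refine (csInf_le bddBelow_rigidityQuotients ⟨p, Ω, _, hp, hΩ, hB, rfl⟩).trans_lt ?_
  rw [div_lt_one (hB.scaledRigidity_pos hp)]
  refine (hlt.trans_le ?_).trans_le (le_scaledRigidity_ball hp one_pos)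
  rw [div_le_div_iff₀ (by norm_num) (by positivity)]
  linarith

lemma criticalRatio_mul_scaledRigidity_le (hp : 1 < p) (hΩa : IsConvexDomain Ωa)
    (hΩb : IsConvexDomain Ωb) : criticalRatio D * scaledRigidity p Ωb ≤ scaledRigidity p Ωa :=
  (le_div_iff₀ (hΩb.scaledRigidity_pos hp)).1
    (csInf_le bddBelow_rigidityQuotients ⟨p, Ωa, Ωb, hp, hΩa, hΩb, rfl⟩)

lemma normalizedRigidity_lt_iff (hp : 1 < p) (ha : 0 < a) (hb : 0 < b)
    (hΩa : Ωa ∈ domainsWithAvgDist D a) (hΩb : Ωb ∈ domainsWithAvgDist D b) :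
    normalizedRigidity p Ωa < normalizedRigidity p Ωb ↔
      b * scaledRigidity p Ωa < a * scaledRigidity p Ωb := by
  have hσa := hΩa.1.scaledRigidity_pos hp
  have hσb := hΩb.1.scaledRigidity_pos hp
  rw [hΩa.1.normalizedRigidity_eq hp, hΩb.1.normalizedRigidity_eq hp, hΩa.2, hΩb.2,
    Real.rpow_lt_rpow_iff (by positivity) (by positivity) (by linarith), div_lt_div_iff₀ ha hb,
    mul_comm b, mul_comm a]

lemma normalizedRigidity_le_iff (hp : 1 < p) (ha : 0 < a) (hb : 0 < b)
    (hΩa : Ωa ∈ domainsWithAvgDist D a) (hΩb : Ωb ∈ domainsWithAvgDist D b) :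
    normalizedRigidity p Ωa ≤ normalizedRigidity p Ωb ↔
      b * scaledRigidity p Ωa ≤ a * scaledRigidity p Ωb := by
  rw [← not_lt, normalizedRigidity_lt_iff hp hb ha hΩb hΩa, not_lt]

lemma IsConvexDomain.exists_mem_domainsWithAvgDist (hΩ : IsConvexDomain Ω) (hp : 1 < p)
    (ha : 0 < a) : ∃ Ω' ∈ domainsWithAvgDist D a, scaledRigidity p Ω' = scaledRigidity p Ω := by
  have hc : 0 < a / avgDist Ω := div_pos ha hΩ.avgDist_pos
  refine ⟨(a / avgDist Ω) • Ω, ⟨hΩ.smul hc.ne', ?_⟩, hΩ.scaledRigidity_smul hp hc⟩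
  rw [avgDist_smul hc, div_mul_cancel₀ _ hΩ.avgDist_pos.ne']

lemma exists_normalizedRigidity_lt (ha : 0 < a) (hb : 0 < b) (h : criticalRatio D * b < a) :
    ∃ q : ℝ, 1 < q ∧ ∃ Ωa ∈ domainsWithAvgDist D a, ∃ Ωb ∈ domainsWithAvgDist D b,
      normalizedRigidity q Ωa < normalizedRigidity q Ωb := by
  obtain ⟨_, ⟨q, Ω, Ω', hq, hΩ, hΩ', rfl⟩, hlt⟩ :=
    exists_lt_of_csInf_lt (rigidityQuotients_nonempty D) ((lt_div_iff₀ hb).2 h)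
  obtain ⟨Ωa, hΩa, hσa⟩ := hΩ.exists_mem_domainsWithAvgDist hq ha
  obtain ⟨Ωb, hΩb, hσb⟩ := hΩ'.exists_mem_domainsWithAvgDist hq hb
  refine ⟨q, hq, Ωa, hΩa, Ωb, hΩb, ?_⟩
  rwa [normalizedRigidity_lt_iff hq ha hb hΩa hΩb, hσa, hσb, mul_comm b,
    ← div_lt_div_iff₀ (hΩ'.scaledRigidity_pos hq) hb]

lemma normalizedRigidity_le_of_le_criticalRatio_mul (hp : 1 < p) (ha : 0 < a) (hb : 0 < b)
    (h : a ≤ criticalRatio D * b) (hΩa : Ωa ∈ domainsWithAvgDist D a)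
    (hΩb : Ωb ∈ domainsWithAvgDist D b) : normalizedRigidity p Ωb ≤ normalizedRigidity p Ωa := by
  rw [normalizedRigidity_le_iff hp hb ha hΩb hΩa]
  calc a * scaledRigidity p Ωb ≤ criticalRatio D * b * scaledRigidity p Ωb :=
        mul_le_mul_of_nonneg_right h (hΩb.1.scaledRigidity_pos hp).le
    _ = b * (criticalRatio D * scaledRigidity p Ωb) := by ring
    _ ≤ b * scaledRigidity p Ωa :=
        mul_le_mul_of_nonneg_left (criticalRatio_mul_scaledRigidity_le hp hΩa.1 hΩb.1) hb.le

lemma normalizedRigidity_lt_of_lt_criticalRatio_mul (hp : 1 < p) (ha : 0 < a) (hb : 0 < b)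
    (h : a < criticalRatio D * b) (hΩa : Ωa ∈ domainsWithAvgDist D a)
    (hΩb : Ωb ∈ domainsWithAvgDist D b) : normalizedRigidity p Ωb < normalizedRigidity p Ωa := by
  rw [normalizedRigidity_lt_iff hp hb ha hΩb hΩa]
  calc a * scaledRigidity p Ωb < criticalRatio D * b * scaledRigidity p Ωb :=
        mul_lt_mul_of_pos_right h (hΩb.1.scaledRigidity_pos hp)
    _ = b * (criticalRatio D * scaledRigidity p Ωb) := by ring
    _ ≤ b * scaledRigidity p Ωa :=
        mul_le_mul_of_nonneg_left (criticalRatio_mul_scaledRigidity_le hp hΩa.1 hΩb.1) hb.le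

end CriticalRatio

end PTorsion

theorem mainTheorem4 (D : ℕ) (hD : 2 ≤ D) :
    ∃ γ : ℝ, 2 / ((D : ℝ) * ((D : ℝ) + 1)) ≤ γ ∧ γ < 1 ∧
      ∀ a b : ℝ, 0 < a → a < b →
        (γ * b < a →
          ∃ q : ℝ, 1 < q ∧
            ∃ Ωa ∈ PTorsion.domainsWithAvgDist D a, ∃ Ωb ∈ PTorsion.domainsWithAvgDist D b,
              PTorsion.normalizedRigidity q Ωa < PTorsion.normalizedRigidity q Ωb) ∧
        (a ≤ γ * b →
          ∀ Ωa ∈ PTorsion.domainsWithAvgDist D a, ∀ Ωb ∈ PTorsion.domainsWithAvgDist D b,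
            ∀ p : ℝ, 1 < p →
              PTorsion.normalizedRigidity p Ωb ≤ PTorsion.normalizedRigidity p Ωa) ∧
        (a < γ * b →
          ∀ Ωa ∈ PTorsion.domainsWithAvgDist D a, ∀ Ωb ∈ PTorsion.domainsWithAvgDist D b,
            ∀ p : ℝ, 1 < p →
              PTorsion.normalizedRigidity p Ωb < PTorsion.normalizedRigidity p Ωa) := by
  have : NeZero D := ⟨by omega⟩
  have hD' : (2 : ℝ) ≤ D := by exact_mod_cast hD
  have hγ : 2 / ((D : ℝ) * (D + 1)) ≤ PTorsion.criticalRatio D :=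
    calc 2 / ((D : ℝ) * (D + 1)) ≤ D / (D * (D + 1)) := by gcongr
      _ = 1 / (D + 1) := by field_simp
      _ ≤ PTorsion.criticalRatio D := PTorsion.one_div_le_criticalRatio D
  refine ⟨PTorsion.criticalRatio D, hγ, PTorsion.criticalRatio_lt_one hD,
    fun a b ha hab => ⟨?_, ?_, ?_⟩⟩
  · exact PTorsion.exists_normalizedRigidity_lt ha (ha.trans hab)
  · exact fun h Ωa hΩa Ωb hΩb p hp =>
      PTorsion.normalizedRigidity_le_of_le_criticalRatio_mul hp ha (ha.trans hab) h hΩa hΩb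
  · exact fun h Ωa hΩa Ωb hΩb p hp =>
      PTorsion.normalizedRigidity_lt_of_lt_criticalRatio_mul hp ha (ha.trans hab) h hΩa hΩb
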